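/- Let $\tilde K/k$ be a finite Galois extension with group $G\cong S_4$, let $G'\le G$ be a subgroup of order $3$ and let $K=\tilde K^{G'}$. Let $\lambda: G\to \mathrm{Perm}(G/G')$, $\lambda_g(xG')=gxG'$. For a regular subgroup $N\le \mathrm{Perm}(G/G')$ normalized by $\lambda(G)$, let $G$ act on $N$ by $n\mapsto\lambda_g n\lambda_g^{-1}$, and on $\tilde K[N]$ by ${}^g\big(\sum_n a_n n\big)=\sum_n g(a_n)\,\lambda_g n\lambda_g^{-1}$. Let $\tilde K[N]^G$ be the $k$-Hopf algebra of fixed points (with the structure maps restricted from $\tilde K[N]$), and let $$\mu_N:\tilde K[N]^G\to \mathrm{End}_k(K),\qquad \mu_N\Big(\sum_n a_n n\Big)(x)=\sum_n a_n\,\big(n^{-1}(\bar 1)\big)(x),$$ where $\bar 1=G'\in G/G'$ and a coset $gG'$ acts on $x\in K$ by $x\mapsto g(x)$. A Hopf Galois structure on $K/k$ is a pair $(H,\mu)$ where $H$ is a finite cocommutative $k$-Hopf algebra and $\mu:H\to\mathrm{End}_k(K)$ makes $K$ an $H$-module algebra such that $K\otimes_k H\to \mathrm{End}_k(K)$, $x\otimes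 h\mapsto x\,\mu(h)(\cdot)$, is bijective; $(H_1,\mu_1)$ and $(H_2,\mu_2)$ are isomorphic if there is a Hopf algebra isomorphism $f:H_1\to H_2$ with $\mu_2\circ f=\mu_1$. Then $[K:k]=8$, and there are an isomorphism $G\cong S_4$ taking $G'$ to $\langle(2,3,4)\rangle$ and a bijection $G/G'\cong\{1,\dots,8\}$ such that, for $\tau=(1,2,3,4)$ and $\sigma=(1,2)$, $\lambda(\tau)=(1,2,3,4)(5,6,7,8)$ and $\lambda(\sigma)=(1,2)(3,5)(4,6)(7,8)$. For any such identifications, let $$N_3=\langle r_3,s_3,t_3\rangle,\quad r_3=(1,6)(2,4)(3,8)(5,7),\ s_3=(1,7)(2,3)(4,8)(5,6),\ t_3=(1,8)(2,5)(3,6)(4,7),$$ $$N_4=\langle r_4,s_4,t_4\rangle,\quad r_4=(1,3)(2,5)(4,7)(6,8),\ s_4=(1,7)(2,6)(3,4)(5,8),\ t_4=(1,6)(2,7)(3,8)(4,5).$$ Then: 1. $N_3$ and $N_4$ are regular and normalized by $\lambda(G)$, and $(\tilde K[N_3]^G,\mu_{N_3})$ and $(\tilde K[N_4]^G,\mu_{N_4})$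 are Hopf Galois structures on $K/k$. 2. These two Hopf Galois structures are not isomorphic. 3. There is exactly one $G$-equivariant group isomorphism $\Phi:N_3\to N_4$. It satisfies $\Phi(r_3)=r_4$, $\Phi(s_3)=s_4$, $\Phi(t_3)=t_4$, and $\sum_n a_n n\mapsto\sum_n a_n\Phi(n)$ restricts to an isomorphism of $k$-Hopf algebras $\tilde K[N_3]^G\to\tilde K[N_4]^G$. -/

import Mathlib

set_option linter.unusedSectionVars false

open scoped TensorProduct

namespace HopfGalois

noncomputable section

universe u v w

variable {k : Type u} {L : Type v} [Field k] [Field L] [Algebra k L]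
variable {N : Type w} [Group N]

/-- The action of `g` on the group algebra `L[N]`: `g • ∑ aₙ n = ∑ g(aₙ) θ(g)(n)`. -/
def act (θ : Gal(L/k) →* MulAut N) (g : Gal(L/k)) :
    MonoidAlgebra L N →ₐ[k] MonoidAlgebra L N :=
  (MonoidAlgebra.mapAlgHom N (g : L →ₐ[k] L)).comp
    (MonoidAlgebra.mapDomainAlgHom k L (θ g).toMonoidHom)

@[simp] theorem act_single (θ : Gal(L/k) →* MulAut N) (g : Gal(L/k)) (n : N) (a : L) :
    act θ g (MonoidAlgebra.single n a) = MonoidAlgebra.single (θ g n) (g a) := by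
  simp [act]

theorem act_smul (θ : Gal(L/k) →* MulAut N) (g : Gal(L/k)) (a : L) (x : MonoidAlgebra L N) :
    act θ g (a • x) = g a • act θ g x := by
  induction x using MonoidAlgebra.induction_linear with
  | zero => simp
  | add x y hx hy => simp [hx, hy]
  | single n b => simp

theorem act_act (θ : Gal(L/k) →* MulAut N) (g g' : Gal(L/k)) (x : MonoidAlgebra L N) :
    act θ g (act θ g' x) = act θ (g * g') x := by
  induction x using MonoidAlgebra.induction_linear with
  | zero => simp
  | add x y hx hy => simp [hx, hy]
  | single n b => simp

/-- The `k`-algebra `L[N]^G` of fixed points of `G = Gal(L/k)` acting semilinearly on `L[N]`, where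
`G` acts on `N` through `θ`. -/
def fixedAlgebra (θ : Gal(L/k) →* MulAut N) : Subalgebra k (MonoidAlgebra L N) where
  carrier := {x | ∀ g, act θ g x = x}
  mul_mem' hx hy g := by rw [map_mul, hx g, hy g]
  add_mem' hx hy g := by rw [map_add, hx g, hy g]
  algebraMap_mem' r g := by rw [AlgHom.commutes]

variable (θ : Gal(L/k) →* MulAut N)

theorem mem_fixedAlgebra {x : MonoidAlgebra L N} :
    x ∈ fixedAlgebra θ ↔ ∀ g, act θ g x = x := Iff.rfl

theorem coeff_act (g : Gal(L/k)) (x : MonoidAlgebra L N) (n : N) :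
    (act θ g x).coeff (θ g n) = g (x.coeff n) := by
  induction x using MonoidAlgebra.induction_linear with
  | zero => simp
  | add x y hx hy => simp [hx, hy]
  | single m b =>
    classical
    simp only [act_single, MonoidAlgebra.coeff_single, Finsupp.single_apply, EmbeddingLike.apply_eq_iff_eq]
    split_ifs <;> simp

theorem coeff_of_mem {x : MonoidAlgebra L N} (hx : x ∈ fixedAlgebra θ) (g : Gal(L/k)) (n : N) :
    x.coeff (θ g n) = g (x.coeff n) := by
  rw [← coeff_act, hx g]

variable [FiniteDimensional k L] 

/-- The trace `∑_g g • x`. -/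
def tr (x : MonoidAlgebra L N) : fixedAlgebra θ :=
  ⟨∑ g : Gal(L/k), act θ g x, fun g => by
    rw [map_sum]
    simp_rw [act_act]
    exact Fintype.sum_equiv (Equiv.mulLeft g) _ _ fun _ => rfl⟩

theorem coe_tr (x : MonoidAlgebra L N) : (tr θ x : MonoidAlgebra L N) = ∑ g, act θ g x := rfl

variable [IsGalois k L]

theorem tr_smul (a : L) (x : fixedAlgebra θ) :
    tr θ (a • (x : MonoidAlgebra L N)) = Algebra.trace k L a • x := by
  apply Subtype.ext
  rw [coe_tr]
  simp_rw [act_smul]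
  have : ∀ g, act θ g (x : MonoidAlgebra L N) = x := x.2
  simp_rw [this]
  rw [← Finset.sum_smul, ← trace_eq_sum_automorphisms]
  simp [algebraMap_smul]

theorem tr_add (x y : MonoidAlgebra L N) : tr θ (x + y) = tr θ x + tr θ y :=
  Subtype.ext (by simp [coe_tr, Finset.sum_add_distrib])

theorem tr_zero : tr θ (0 : MonoidAlgebra L N) = 0 :=
  Subtype.ext (by simp [coe_tr])

theorem linearIndependent_val {ι : Type*} {b : ι → fixedAlgebra θ} (hb : LinearIndependent k b) :
    LinearIndependent L (fun i => (b i : MonoidAlgebra L N)) := by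
  rw [linearIndependent_iff'] at hb ⊢
  intro s c hc i hi
  have key : ∀ a : L, Algebra.trace k L (a * c i) = 0 := by
    intro a
    refine hb s (fun i => Algebra.trace k L (a * c i)) ?_ i hi
    let T : MonoidAlgebra L N →+ fixedAlgebra θ :=
      { toFun := tr θ, map_zero' := tr_zero θ, map_add' := tr_add θ }
    have h0 : T (a • ∑ i ∈ s, c i • (b i : MonoidAlgebra L N)) = 0 := by rw [hc, smul_zero, map_zero]
    rw [Finset.smul_sum, map_sum] at h0
    rw [← h0]
    refine Finset.sum_congr rfl fun j _ => ?_
    rw [smul_smul]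
    exact (tr_smul θ _ _).symm
  have := (traceForm_nondegenerate k L).1 (c i) (fun a => by
    rw [Algebra.traceForm_apply, mul_comm]; exact key a)
  exact this

theorem injective_of_basis {U U' ι : Type*} [AddCommMonoid U] [Module k U] [AddCommMonoid U']
    [Module k U'] [Module L U'] [IsScalarTower k L U'] (b : Module.Basis ι k U) (f : U →ₗ[k] U')
    (h : LinearIndependent L (fun i => f (b i))) : Function.Injective f := by
  have h' : LinearIndependent k (fun i => f (b i)) :=
    h.restrict_scalars (by
      intro x y hxy
      simpa [Algebra.smul_def] using hxy)
  have h2 : ∀ x, f x = Finsupp.linearCombination k (fun i => f (b i)) (b.repr x) := fun x => by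
    conv_lhs => rw [← b.linearCombination_repr x, Finsupp.apply_linearCombination]
    rfl
  intro x y hxy
  rw [h2, h2] at hxy
  exact b.repr.injective (h' hxy)

theorem linearIndependent_tensor {U V U' V' ι κ : Type*} [AddCommMonoid U] [Module k U]
    [AddCommMonoid V] [Module k V] [AddCommGroup U'] [Module k U'] [Module L U']
    [AddCommGroup V'] [Module L V'] [IsScalarTower k L U']
    (b : Module.Basis ι k U) (c : Module.Basis κ k V) (f : U → U') (g : V → V')
    (hb : LinearIndependent L fun i => f (b i)) (hc : LinearIndependent L fun i => g (c i))
    (F : U ⊗[k] V → U' ⊗[L] V') (hF : ∀ u v, F (u ⊗ₜ v) = f u ⊗ₜ g v) :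
    LinearIndependent L fun i => F (b.tensorProduct c i) := by
  have e : ∀ i, F (b.tensorProduct c i) = f (b i.1) ⊗ₜ[L] g (c i.2) := fun i => by
    rw [Module.Basis.tensorProduct_apply', hF]
  have h := LinearIndependent.tmul_of_flat_left (R := L) (v := fun i => f (b i))
    (w := fun i => g (c i)) hb hc
  have e' : (fun i => F (b.tensorProduct c i)) =
      fun i : ι × κ => f (b i.1) ⊗ₜ[L] g (c i.2) := funext e
  rw [e']
  exact h

abbrev basisH : Module.Basis (Module.Basis.ofVectorSpaceIndex k (fixedAlgebra θ)) k
    (fixedAlgebra θ) := Module.Basis.ofVectorSpace k (fixedAlgebra θ)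

/-- `L[N]^G ⊗ₖ L[N]^G → L[N] ⊗_L L[N]`. -/
def emb₂ : fixedAlgebra θ ⊗[k] fixedAlgebra θ →ₐ[k] MonoidAlgebra L N ⊗[L] MonoidAlgebra L N :=
  (Algebra.TensorProduct.mapOfCompatibleSMul L k k (MonoidAlgebra L N) (MonoidAlgebra L N)).comp
    (Algebra.TensorProduct.map (fixedAlgebra θ).val (fixedAlgebra θ).val)

@[simp] theorem emb₂_tmul (x y : fixedAlgebra θ) :
    emb₂ θ (x ⊗ₜ y) = (x : MonoidAlgebra L N) ⊗ₜ[L] (y : MonoidAlgebra L N) := rfl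

theorem linearIndependent_emb₂ :
    LinearIndependent L fun i => emb₂ θ ((basisH θ).tensorProduct (basisH θ) i) := by
  have h := linearIndependent_val θ (basisH θ).linearIndependent
  exact linearIndependent_tensor _ _ Subtype.val Subtype.val h h _ (emb₂_tmul θ)

theorem emb₂_injective : Function.Injective (emb₂ θ) :=
  injective_of_basis (L := L) _ (emb₂ θ).toLinearMap (linearIndependent_emb₂ θ)

/-- `H ⊗ (H ⊗ H) → L[N] ⊗ (L[N] ⊗ L[N])`. -/
def emb₃ : fixedAlgebra θ ⊗[k] (fixedAlgebra θ ⊗[k] fixedAlgebra θ) →ₗ[k]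
    MonoidAlgebra L N ⊗[L] (MonoidAlgebra L N ⊗[L] MonoidAlgebra L N) :=
  (TensorProduct.mapOfCompatibleSMul L k k (MonoidAlgebra L N)
    (MonoidAlgebra L N ⊗[L] MonoidAlgebra L N)) ∘ₗ
    (TensorProduct.map (fixedAlgebra θ).val.toLinearMap (emb₂ θ).toLinearMap)

@[simp] theorem emb₃_tmul (x : fixedAlgebra θ) (y : fixedAlgebra θ ⊗[k] fixedAlgebra θ) :
    emb₃ θ (x ⊗ₜ y) = (x : MonoidAlgebra L N) ⊗ₜ[L] (emb₂ θ y) := rfl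

theorem emb₃_injective : Function.Injective (emb₃ θ) := by
  have h := linearIndependent_val θ (basisH θ).linearIndependent
  exact injective_of_basis (L := L) _ (emb₃ θ)
    (linearIndependent_tensor (basisH θ) _ Subtype.val (emb₂ θ) h (linearIndependent_emb₂ θ) _
      (emb₃_tmul θ))

open Classical in
theorem exists_dual : ∃ (n : ℕ) (x y : Fin n → L), ∀ g h : Gal(L/k),
    ∑ i, g (y i) * h (x i) = if g = h then 1 else 0 := by
  let b := Module.finBasis k L
  have hv : LinearIndependent L
      (fun (h : Gal(L/k)) (i : Fin (Module.finrank k L)) => h (b i)) := by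
    have h0 := linearIndependent_algHom_toLinearMap k L L
    have h1 : LinearIndependent L (fun (h : Gal(L/k)) => (h : L →ₐ[k] L).toLinearMap) :=
      h0.comp (fun h : Gal(L/k) => (h : L →ₐ[k] L)) AlgEquiv.coe_toAlgHom_injective
    rw [Fintype.linearIndependent_iff] at h1 ⊢
    intro c hc
    refine h1 c (b.ext fun i => ?_)
    simpa using congrFun hc i
  obtain ⟨φ, hφ⟩ := LinearMap.exists_leftInverse_of_injective _ (LinearMap.ker_eq_bot.2 hv)
  have hφ1 : ∀ h : Gal(L/k), φ (fun i => h (b i)) 1 = if (1 : Gal(L/k)) = h then 1 else 0 := by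
    intro h
    have := DFunLike.congr_fun (LinearMap.congr_fun hφ (Finsupp.single h 1)) 1
    simpa [Finsupp.single_apply, eq_comm] using this
  refine ⟨_, b, fun i => φ (Pi.single i 1) 1, fun g h => ?_⟩
  have h2 : ∀ h : Gal(L/k), ∑ i, φ (Pi.single i 1) 1 * h (b i) =
      if (1 : Gal(L/k)) = h then 1 else 0 := by
    intro h
    rw [← hφ1 h, LinearMap.pi_apply_eq_sum_univ φ (fun i => h (b i)), Finsupp.finsetSum_apply]
    refine Finset.sum_congr rfl fun i _ => ?_
    rw [Finsupp.smul_apply, smul_eq_mul, mul_comm]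
    congr 3
    ext j
    simp [Pi.single_apply, eq_comm]
  have h3 := congrArg g (h2 (g⁻¹ * h))
  rw [map_sum] at h3
  simp only [map_mul, AlgEquiv.mul_apply] at h3
  have h4 : ∀ z, g (g⁻¹ z) = z := fun z => g.apply_symm_apply z
  simp only [h4] at h3
  rw [h3, eq_comm (a := (1 : Gal(L/k))), inv_mul_eq_one]
  split_ifs <;> simp


theorem exists_mem_tmul (x : MonoidAlgebra L N) :
    Coalgebra.comul (R := L) (tr θ x : MonoidAlgebra L N) ∈ (emb₂ θ).range := by
  classical
  induction x using MonoidAlgebra.induction_linear with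
  | zero => rw [tr_zero]; simp
  | add x y hx hy => rw [tr_add, Subalgebra.coe_add, map_add]; exact add_mem hx hy
  | single n b =>
    obtain ⟨m, x, y, hxy⟩ := exists_dual (k := k) (L := L)
    let T : Fin m → fixedAlgebra θ := fun i => tr θ (MonoidAlgebra.single n (x i))
    have hT : ∀ g : Gal(L/k), MonoidAlgebra.single (θ g n) (1 : L) =
        ∑ i, g (y i) • (T i : MonoidAlgebra L N) := by
      intro g
      simp_rw [T, coe_tr, act_single, Finset.smul_sum, MonoidAlgebra.smul_single, smul_eq_mul]
      rw [Finset.sum_comm]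
      have h1 : ∀ h : Gal(L/k), ∑ i, MonoidAlgebra.single (θ h n) (g (y i) * h (x i)) =
          MonoidAlgebra.single (θ h n) (if g = h then (1 : L) else 0) := fun h => by
        rw [← hxy g h]
        exact (map_sum (MonoidAlgebra.singleAddHom (θ h n)) _ _).symm
      simp_rw [h1]
      rw [Finset.sum_eq_single g] <;> simp +contextual [eq_comm]
    refine ⟨∑ i, ∑ j, Algebra.trace k L (b * y i * y j) • (T i ⊗ₜ T j), ?_⟩
    have hc : Coalgebra.comul (R := L) (tr θ (MonoidAlgebra.single n b) : MonoidAlgebra L N) =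
        ∑ g : Gal(L/k), g b • (MonoidAlgebra.single (θ g n) (1 : L) ⊗ₜ[L]
          MonoidAlgebra.single (θ g n) (1 : L)) := by
      rw [coe_tr, map_sum]
      refine Finset.sum_congr rfl fun g _ => ?_
      have : MonoidAlgebra.single (θ g n) (g b) =
          g b • MonoidAlgebra.single (θ g n) (1 : L) := by simp
      rw [act_single, this, map_smul, MonoidAlgebra.comul_single]
      simp
    have hz : emb₂ θ (∑ i, ∑ j, Algebra.trace k L (b * y i * y j) • (T i ⊗ₜ T j)) =
        ∑ i, ∑ j, Algebra.trace k L (b * y i * y j) •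
          ((T i : MonoidAlgebra L N) ⊗ₜ[L] (T j : MonoidAlgebra L N)) := by
      rw [map_sum]
      refine Finset.sum_congr rfl fun i _ => ?_
      rw [map_sum]
      refine Finset.sum_congr rfl fun j _ => ?_
      rw [map_smul, emb₂_tmul]
    refine hz.trans ?_
    rw [hc]
    have hg : ∀ g : Gal(L/k), g b • (MonoidAlgebra.single (θ g n) (1 : L) ⊗ₜ[L]
          MonoidAlgebra.single (θ g n) (1 : L)) = ∑ i, ∑ j, g (b * y i * y j) •
          ((T i : MonoidAlgebra L N) ⊗ₜ[L] (T j : MonoidAlgebra L N)) := by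
      intro g
      rw [hT, TensorProduct.sum_tmul, Finset.smul_sum]
      refine Finset.sum_congr rfl fun i _ => ?_
      rw [TensorProduct.tmul_sum, Finset.smul_sum]
      refine Finset.sum_congr rfl fun j _ => ?_
      rw [TensorProduct.tmul_smul, ← TensorProduct.smul_tmul', smul_smul, smul_smul, map_mul,
        map_mul, mul_right_comm, mul_assoc]
    simp_rw [hg]
    symm
    refine Finset.sum_comm.trans (Finset.sum_congr rfl fun i _ => ?_)
    refine Finset.sum_comm.trans (Finset.sum_congr rfl fun j _ => ?_)
    rw [← algebraMap_smul L, trace_eq_sum_automorphisms, Finset.sum_smul]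

theorem comul_mem (x : fixedAlgebra θ) :
    Coalgebra.comul (R := L) (x : MonoidAlgebra L N) ∈ (emb₂ θ).range := by
  obtain ⟨c, hc⟩ := Algebra.trace_surjective k L 1
  have := exists_mem_tmul θ (c • (x : MonoidAlgebra L N))
  rwa [tr_smul, hc, one_smul] at this

theorem counit_mem (x : fixedAlgebra θ) :
    Coalgebra.counit (R := L) (x : MonoidAlgebra L N) ∈ (⊥ : Subalgebra k L) := by
  have h : ∀ (g : Gal(L/k)) (y : MonoidAlgebra L N),
      Coalgebra.counit (R := L) (act θ g y) = g (Coalgebra.counit (R := L) y) := by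
    intro g y
    induction y using MonoidAlgebra.induction_linear with
    | zero => simp
    | add x y hx hy => simp [hx, hy]
    | single n b => simp
  have := (IsGalois.mem_range_algebraMap_iff_fixed (F := k)
    (Coalgebra.counit (R := L) (x : MonoidAlgebra L N))).2 fun g => by rw [← h, x.2 g]
  exact this

theorem antipode_mem (x : fixedAlgebra θ) :
    HopfAlgebra.antipode L (x : MonoidAlgebra L N) ∈ fixedAlgebra θ := by
  have h : ∀ (g : Gal(L/k)) (y : MonoidAlgebra L N),
      HopfAlgebra.antipode L (act θ g y) = act θ g (HopfAlgebra.antipode L y) := by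
    intro g y
    induction y using MonoidAlgebra.induction_linear with
    | zero => simp
    | add x y hx hy => simp [hx, hy]
    | single n b => simp
  intro g
  rw [← h, x.2 g]

/-- Comultiplication of `L[N]^G`: the restriction of the one of `L[N]`. -/
def comulHom : fixedAlgebra θ →ₐ[k] fixedAlgebra θ ⊗[k] fixedAlgebra θ :=
  (AlgEquiv.ofInjective (emb₂ θ) (emb₂_injective θ)).symm.toAlgHom.comp
    ((((Bialgebra.comulAlgHom L (MonoidAlgebra L N)).restrictScalars k).comp
      (fixedAlgebra θ).val).codRestrict (emb₂ θ).range (comul_mem θ))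

theorem emb₂_comulHom (x : fixedAlgebra θ) :
    emb₂ θ (comulHom θ x) = Coalgebra.comul (R := L) (x : MonoidAlgebra L N) := by
  have := (AlgEquiv.ofInjective (emb₂ θ) (emb₂_injective θ)).apply_symm_apply
    ⟨_, comul_mem θ x⟩
  exact congrArg Subtype.val this

/-- Counit of `L[N]^G`: the restriction of the one of `L[N]`. -/
def counitHom : fixedAlgebra θ →ₐ[k] k :=
  (Algebra.botEquiv k L).toAlgHom.comp
    ((((Bialgebra.counitAlgHom L (MonoidAlgebra L N)).restrictScalars k).comp
      (fixedAlgebra θ).val).codRestrict ⊥ (counit_mem θ))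

theorem algebraMap_counitHom (x : fixedAlgebra θ) :
    algebraMap k L (counitHom θ x) = Coalgebra.counit (R := L) (x : MonoidAlgebra L N) := by
  have := (Algebra.botEquiv k L).symm_apply_apply ⟨_, counit_mem θ x⟩
  rw [Algebra.botEquiv_symm_apply] at this
  exact congrArg Subtype.val this

/-- Antipode of `L[N]^G`: the restriction of the one of `L[N]`. -/
def antipodeHom : fixedAlgebra θ →ₗ[k] fixedAlgebra θ :=
  (((HopfAlgebra.antipode L (A := MonoidAlgebra L N)).restrictScalars k).comp
    (fixedAlgebra θ).val.toLinearMap).codRestrict (fixedAlgebra θ).toSubmodule (antipode_mem θ)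

theorem coe_antipodeHom (x : fixedAlgebra θ) :
    (antipodeHom θ x : MonoidAlgebra L N) = HopfAlgebra.antipode L (x : MonoidAlgebra L N) := rfl

open Coalgebra in
theorem coassoc_comulHom (x : fixedAlgebra θ) :
    TensorProduct.assoc k _ _ _ ((comulHom θ).toLinearMap.rTensor _ (comulHom θ x)) =
      (comulHom θ).toLinearMap.lTensor _ (comulHom θ x) := by
  apply emb₃_injective θ
  have h1 : ∀ t : fixedAlgebra θ ⊗[k] fixedAlgebra θ,
      emb₃ θ (TensorProduct.assoc k _ _ _ ((comulHom θ).toLinearMap.rTensor _ t)) =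
      TensorProduct.assoc L _ _ _ (comul.rTensor _ (emb₂ θ t)) := by
    intro t
    induction t with
    | zero => simp only [LinearMap.map_zero, LinearEquiv.map_zero, map_zero (emb₂ θ)]
    | add x y hx hy =>
      simp only [LinearMap.map_add, LinearEquiv.map_add, map_add (emb₂ θ), hx, hy]
    | tmul x y =>
      have h2 : ∀ s : fixedAlgebra θ ⊗[k] fixedAlgebra θ,
          emb₃ θ (TensorProduct.assoc k _ _ _ (s ⊗ₜ[k] y)) =
          TensorProduct.assoc L _ _ _ (emb₂ θ s ⊗ₜ[L] (y : MonoidAlgebra L N)) := by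
        intro s
        induction s with
        | zero => simp only [TensorProduct.zero_tmul, LinearMap.map_zero, LinearEquiv.map_zero,
            map_zero (emb₂ θ)]
        | add x y hx hy => simp only [LinearMap.map_add, LinearEquiv.map_add, map_add (emb₂ θ), hx,
            hy, TensorProduct.add_tmul]
        | tmul a b => rfl
      have := h2 (comulHom θ x)
      rw [emb₂_comulHom] at this
      exact this
  have h3 : ∀ t : fixedAlgebra θ ⊗[k] fixedAlgebra θ,
      emb₃ θ ((comulHom θ).toLinearMap.lTensor _ t) = comul.lTensor _ (emb₂ θ t) := by
    intro t
    induction t with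
    | zero => simp
    | add x y hx hy => simp only [map_add, hx, hy]
    | tmul x y =>
      have : emb₃ θ ((comulHom θ).toLinearMap.lTensor _ (x ⊗ₜ[k] y)) =
        (x : MonoidAlgebra L N) ⊗ₜ[L] (emb₂ θ (comulHom θ y)) := rfl
      rw [this, emb₂_comulHom]
      rfl
  rw [h1, h3, emb₂_comulHom]
  exact coassoc_apply _

open Coalgebra in
theorem rTensor_counitHom (x : fixedAlgebra θ) :
    (counitHom θ).toLinearMap.rTensor _ (comulHom θ x) = 1 ⊗ₜ[k] x := by
  apply (TensorProduct.lid k (fixedAlgebra θ)).injective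
  apply Subtype.ext
  have h1 : ∀ t : fixedAlgebra θ ⊗[k] fixedAlgebra θ,
      (TensorProduct.lid k (fixedAlgebra θ) ((counitHom θ).toLinearMap.rTensor _ t) :
        MonoidAlgebra L N) = TensorProduct.lid L _ (counit.rTensor _ (emb₂ θ t)) := by
    intro t
    induction t with
    | zero => simp
    | add x y hx hy => simp only [map_add, hx, hy, Subalgebra.coe_add]
    | tmul x y =>
      rw [emb₂_tmul, LinearMap.rTensor_tmul, LinearMap.rTensor_tmul, TensorProduct.lid_tmul,
        TensorProduct.lid_tmul, ← algebraMap_counitHom, algebraMap_smul]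
      rfl
  rw [h1, emb₂_comulHom, rTensor_counit_comul, TensorProduct.lid_tmul, TensorProduct.lid_tmul,
    one_smul, one_smul]

open Coalgebra in
theorem lTensor_counitHom (x : fixedAlgebra θ) :
    (counitHom θ).toLinearMap.lTensor _ (comulHom θ x) = x ⊗ₜ[k] 1 := by
  apply (TensorProduct.rid k (fixedAlgebra θ)).injective
  apply Subtype.ext
  have h1 : ∀ t : fixedAlgebra θ ⊗[k] fixedAlgebra θ,
      (TensorProduct.rid k (fixedAlgebra θ) ((counitHom θ).toLinearMap.lTensor _ t) :
        MonoidAlgebra L N) = TensorProduct.rid L _ (counit.lTensor _ (emb₂ θ t)) := by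
    intro t
    induction t with
    | zero => simp
    | add x y hx hy => simp only [map_add, hx, hy, Subalgebra.coe_add]
    | tmul x y =>
      rw [emb₂_tmul, LinearMap.lTensor_tmul, LinearMap.lTensor_tmul, TensorProduct.rid_tmul,
        TensorProduct.rid_tmul, ← algebraMap_counitHom, algebraMap_smul]
      rfl
  rw [h1, emb₂_comulHom, lTensor_counit_comul, TensorProduct.rid_tmul, TensorProduct.rid_tmul,
    one_smul, one_smul]

instance instCoalgebra : Coalgebra k (fixedAlgebra θ) where
  comul := (comulHom θ).toLinearMap
  counit := (counitHom θ).toLinearMap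
  coassoc := LinearMap.ext (coassoc_comulHom θ)
  rTensor_counit_comp_comul := LinearMap.ext (rTensor_counitHom θ)
  lTensor_counit_comp_comul := LinearMap.ext (lTensor_counitHom θ)

instance instBialgebra : Bialgebra k (fixedAlgebra θ) :=
  Bialgebra.mk' k (fixedAlgebra θ) (map_one (counitHom θ)) (map_mul (counitHom θ) _ _)
    (map_one (comulHom θ)) (map_mul (comulHom θ) _ _)

theorem comul_eq (x : fixedAlgebra θ) : Coalgebra.comul (R := k) x = comulHom θ x := rfl

theorem counit_eq (x : fixedAlgebra θ) : Coalgebra.counit (R := k) x = counitHom θ x := rfl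

theorem coe_mul'_emb₂ (t : fixedAlgebra θ ⊗[k] fixedAlgebra θ) :
    (LinearMap.mul' k (fixedAlgebra θ) t : MonoidAlgebra L N) =
      LinearMap.mul' L (MonoidAlgebra L N) (emb₂ θ t) := by
  induction t with
  | zero => simp
  | add x y hx hy => simp only [map_add, hx, hy, Subalgebra.coe_add]
  | tmul x y => simp

/-- The `k`-Hopf algebra `L[N]^G`. All structure maps are restrictions of those of the `L`-Hopf
algebra `L[N]`, via the inclusion of `L[N]^G ⊗ₖ L[N]^G` in `L[N] ⊗_L L[N]`. -/
instance instHopfAlgebra : HopfAlgebra k (fixedAlgebra θ) where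
  antipode := antipodeHom θ
  mul_antipode_rTensor_comul := by
    ext1 x
    apply Subtype.ext
    have h1 : ∀ t : fixedAlgebra θ ⊗[k] fixedAlgebra θ,
        emb₂ θ ((antipodeHom θ).rTensor _ t) =
          (HopfAlgebra.antipode L).rTensor _ (emb₂ θ t) := by
      intro t
      induction t with
      | zero => simp
      | add x y hx hy => simp only [map_add, hx, hy]
      | tmul x y => rfl
    simp only [LinearMap.comp_apply]
    rw [coe_mul'_emb₂, h1, comul_eq, emb₂_comulHom, HopfAlgebra.mul_antipode_rTensor_comul_apply,
      ← algebraMap_counitHom, counit_eq, ← IsScalarTower.algebraMap_apply]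
    rfl
  mul_antipode_lTensor_comul := by
    ext1 x
    apply Subtype.ext
    have h1 : ∀ t : fixedAlgebra θ ⊗[k] fixedAlgebra θ,
        emb₂ θ ((antipodeHom θ).lTensor _ t) =
          (HopfAlgebra.antipode L).lTensor _ (emb₂ θ t) := by
      intro t
      induction t with
      | zero => simp
      | add x y hx hy => simp only [map_add, hx, hy]
      | tmul x y => rfl
    simp only [LinearMap.comp_apply]
    rw [coe_mul'_emb₂, h1, comul_eq, emb₂_comulHom, HopfAlgebra.mul_antipode_lTensor_comul_apply,
      ← algebraMap_counitHom, counit_eq, ← IsScalarTower.algebraMap_apply]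
    rfl


/-! ### Hopf Galois structures -/

section Structures

/-- The `k`-linear map `K ⊗ H → End_k(K)`, `x ⊗ h ↦ (y ↦ x * μ h y)`. -/
def galoisMap {F K H : Type*} [Field F] [Field K] [Algebra F K] [Ring H] [HopfAlgebra F H]
    (μ : H →ₗ[F] Module.End F K) : K ⊗[F] H →ₗ[F] Module.End F K :=
  LinearMap.mul' F (Module.End F K) ∘ₗ TensorProduct.map (Algebra.lmul F K).toLinearMap μ

/-- `(H, μ)` is a Hopf Galois structure on `K/F`: `H` is a finite cocommutative `F`-Hopf algebra,
`μ` makes `K` into an `H`-module algebra, and `K ⊗ H → End_F(K)` is bijective. -/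
structure IsHopfGaloisStructure {F K H : Type*} [Field F] [Field K] [Algebra F K] [Ring H]
    [HopfAlgebra F H] (μ : H →ₗ[F] Module.End F K) : Prop where
  finite : Module.Finite F H
  cocomm : Coalgebra.IsCocomm F H
  map_one : μ 1 = 1
  map_mul : ∀ h h', μ (h * h') = μ h * μ h'
  apply_one : ∀ h, μ h 1 = algebraMap F K (Coalgebra.counit (R := F) h)
  /-- `h(xy) = ∑ h₁(x) h₂(y)` where `Δ(h) = ∑ h₁ ⊗ h₂`. -/
  apply_mul : ∀ h x y, μ h (x * y) = LinearMap.mul' F K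
    (TensorProduct.map (μ.flip x) (μ.flip y) (Coalgebra.comul (R := F) h))
  bijective : Function.Bijective (galoisMap μ)

/-- Isomorphism of `(H₁, μ₁)` and `(H₂, μ₂)`: a Hopf algebra isomorphism `f` with `μ₂ ∘ f = μ₁`. (A
bialgebra isomorphism between Hopf algebras automatically commutes with the antipodes.) -/
def HopfGaloisIsomorphic {F K H₁ H₂ : Type*} [Field F] [Field K] [Algebra F K] [Ring H₁]
    [HopfAlgebra F H₁] [Ring H₂] [HopfAlgebra F H₂] (μ₁ : H₁ →ₗ[F] Module.End F K)
    (μ₂ : H₂ →ₗ[F] Module.End F K) : Prop :=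
  ∃ f : H₁ ≃ₐc[F] H₂, ∀ h, μ₂ (f h) = μ₁ h

end Structures

/-! ### The structure attached to a subgroup of `Perm (G ⧸ G')` -/

section GreitherPareigis

/-- A regular (simply transitive) group of permutations. -/
def IsRegular {X : Type*} (N : Subgroup (Equiv.Perm X)) : Prop :=
  ∀ x y : X, ∃! n : N, (n : Equiv.Perm X) x = y

variable (G' : Subgroup Gal(L/k))

/-- `λ : G → Perm (G ⧸ G')`, `λ_g (x G') = g x G'`. -/
def lam : Gal(L/k) →* Equiv.Perm (Gal(L/k) ⧸ G') := MulAction.toPermHom _ _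

variable {G'}

/-- `λ(G)` normalizes `N`. -/
def Normalized (N : Subgroup (Equiv.Perm (Gal(L/k) ⧸ G'))) : Prop :=
  (lam G').range ≤ Subgroup.normalizer (N : Set (Equiv.Perm (Gal(L/k) ⧸ G')))

/-- The action of `G` on `N` by conjugation via `λ`. -/
def conjAct (N : Subgroup (Equiv.Perm (Gal(L/k) ⧸ G'))) (hN : Normalized N) :
    Gal(L/k) →* MulAut N :=
  N.normalizerMonoidHom.comp ((lam G').codRestrict _ fun g => hN ⟨g, rfl⟩)

theorem coe_conjAct (N : Subgroup (Equiv.Perm (Gal(L/k) ⧸ G'))) (hN : Normalized N)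
    (g : Gal(L/k)) (n : N) :
    (conjAct N hN g n : Equiv.Perm (Gal(L/k) ⧸ G')) = lam G' g * n * (lam G' g)⁻¹ := rfl

/-- The coset `g G'` as an embedding `K → L`, `x ↦ g x`, where `K` is the fixed field of `G'`. -/
def cosetHom (q : Gal(L/k) ⧸ G') : IntermediateField.fixedField G' →ₐ[k] L :=
  Quotient.liftOn' q
    (fun g => (g : L →ₐ[k] L).comp (IntermediateField.fixedField G').val) fun a b hab => by
      rw [QuotientGroup.leftRel_apply] at hab
      ext x
      have hx : (a⁻¹ * b) (x : L) = x := x.2 ⟨_, hab⟩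
      have := congrArg a hx
      rw [← AlgEquiv.mul_apply, mul_inv_cancel_left] at this
      exact this.symm

@[simp] theorem cosetHom_mk (g : Gal(L/k)) (x : IntermediateField.fixedField G') :
    cosetHom (g : Gal(L/k) ⧸ G') x = g x := rfl

theorem cosetHom_lam (g : Gal(L/k)) (q : Gal(L/k) ⧸ G') (x : IntermediateField.fixedField G') :
    cosetHom (lam G' g q) x = g (cosetHom q x) := by
  induction q using QuotientGroup.induction_on with
  | H a => rfl

/-- `∑ aₙ (n⁻¹(1̄))(x)` for `∑ aₙ n ∈ L[N]`. -/
def preAct (N : Subgroup (Equiv.Perm (Gal(L/k) ⧸ G'))) (h : MonoidAlgebra L N)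
    (x : IntermediateField.fixedField G') : L :=
  h.coeff.sum fun n a =>
    a * cosetHom ((n : Equiv.Perm (Gal(L/k) ⧸ G'))⁻¹ ((1 : Gal(L/k)) : Gal(L/k) ⧸ G')) x

theorem preAct_mem (N : Subgroup (Equiv.Perm (Gal(L/k) ⧸ G'))) (hN : Normalized N)
    (h : fixedAlgebra (conjAct N hN)) (x : IntermediateField.fixedField G') :
    preAct N h x ∈ IntermediateField.fixedField G' := by
  rintro ⟨u, hu⟩
  change u (preAct N h x) = preAct N h x
  have := Fintype.ofFinite N
  rw [preAct, Finsupp.sum_fintype _ _ (by simp), map_sum]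
  refine Fintype.sum_equiv (conjAct N hN u).toEquiv _ _ fun n => ?_
  change _ = (h : MonoidAlgebra L N).coeff (conjAct N hN u n) * _
  rw [map_mul, coeff_of_mem (conjAct N hN) h.2, ← cosetHom_lam]
  congr 3
  have h1 : lam G' u ((1 : Gal(L/k)) : Gal(L/k) ⧸ G') = ((1 : Gal(L/k)) : Gal(L/k) ⧸ G') := by
    change ((u * 1 : Gal(L/k)) : Gal(L/k) ⧸ G') = _
    rw [mul_one, QuotientGroup.eq, mul_one]
    exact inv_mem hu
  have h2 : (lam G' u)⁻¹ ((1 : Gal(L/k)) : Gal(L/k) ⧸ G') = ((1 : Gal(L/k)) : Gal(L/k) ⧸ G') := by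
    rw [Equiv.Perm.inv_eq_iff_eq, h1]
  change _ = (conjAct N hN u n : Equiv.Perm (Gal(L/k) ⧸ G'))⁻¹ _
  rw [coe_conjAct, mul_inv_rev, mul_inv_rev, inv_inv, Equiv.Perm.mul_apply, Equiv.Perm.mul_apply,
    h2]

/-- The action `μ : L[N]^G → End_k(K)`, `μ(∑ aₙ n)(x) = ∑ aₙ (n⁻¹(1̄))(x)`. -/
def hopfAction (N : Subgroup (Equiv.Perm (Gal(L/k) ⧸ G'))) (hN : Normalized N) :
    fixedAlgebra (conjAct N hN) →ₗ[k] Module.End k (IntermediateField.fixedField G') :=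
  LinearMap.mk₂ k (fun h x => (⟨preAct N h x, preAct_mem N hN h x⟩ :
      IntermediateField.fixedField G'))
    (fun h h' x => Subtype.ext <| by
      simp only [preAct, Subalgebra.coe_add, MonoidAlgebra.coeff_add, IntermediateField.coe_add]
      exact Finsupp.sum_add_index' (by simp) (by intros; ring))
    (fun c h x => Subtype.ext <| by
      have := Fintype.ofFinite N
      simp only [preAct, IntermediateField.coe_smul]
      rw [Finsupp.sum_fintype _ _ (by simp), Finsupp.sum_fintype _ _ (by simp), Finset.smul_sum]
      refine Finset.sum_congr rfl fun n _ => ?_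
      exact smul_mul_assoc c _ _)
    (fun h x y => Subtype.ext <| by
      simp only [preAct, IntermediateField.coe_add, map_add, mul_add, Finsupp.sum_add])
    (fun c h x => Subtype.ext <| by
      simp only [preAct, IntermediateField.coe_smul, map_smul, mul_smul_comm, Finsupp.smul_sum])

theorem coe_hopfAction (N : Subgroup (Equiv.Perm (Gal(L/k) ⧸ G'))) (hN : Normalized N)
    (h : fixedAlgebra (conjAct N hN)) (x : IntermediateField.fixedField G') :
    (hopfAction N hN h x : L) = (h : MonoidAlgebra L N).coeff.sum fun n a => a * cosetHom
      ((n : Equiv.Perm (Gal(L/k) ⧸ G'))⁻¹ ((1 : Gal(L/k)) : Gal(L/k) ⧸ G')) x := rfl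

end GreitherPareigis

/-! ### The groups `N₃` and `N₄` -/

section Permutations

open Equiv

/-! The point `i ∈ {1, …, 8}` is written `(i : Fin 8)`, so `8` is `0 : Fin 8`; likewise for
`{1, …, 4}` and `Fin 4`. -/

/-- `(1,2,3,4)` -/
def tau : Perm (Fin 4) := List.formPerm [1, 2, 3, 4]

/-- `(1,2)` -/
def sigma : Perm (Fin 4) := swap 1 2

/-- `(1,2,3,4)(5,6,7,8)` -/
def lamTau : Perm (Fin 8) := List.formPerm [1, 2, 3, 4] * List.formPerm [5, 6, 7, 8]

/-- `(1,2)(3,5)(4,6)(7,8)` -/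
def lamSigma : Perm (Fin 8) := swap 1 2 * swap 3 5 * swap 4 6 * swap 7 8

/-- `(1,6)(2,4)(3,8)(5,7)` -/
def r₃ : Perm (Fin 8) := swap 1 6 * swap 2 4 * swap 3 8 * swap 5 7

/-- `(1,7)(2,3)(4,8)(5,6)` -/
def s₃ : Perm (Fin 8) := swap 1 7 * swap 2 3 * swap 4 8 * swap 5 6

/-- `(1,8)(2,5)(3,6)(4,7)` -/
def t₃ : Perm (Fin 8) := swap 1 8 * swap 2 5 * swap 3 6 * swap 4 7

/-- `(1,3)(2,5)(4,7)(6,8)` -/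
def r₄ : Perm (Fin 8) := swap 1 3 * swap 2 5 * swap 4 7 * swap 6 8

/-- `(1,7)(2,6)(3,4)(5,8)` -/
def s₄ : Perm (Fin 8) := swap 1 7 * swap 2 6 * swap 3 4 * swap 5 8

/-- `(1,6)(2,7)(3,8)(4,5)` -/
def t₄ : Perm (Fin 8) := swap 1 6 * swap 2 7 * swap 3 8 * swap 4 5

/-- An identification of `G` with `S₄` taking `G'` to `⟨(2,3,4)⟩`, with an enumeration of `G ⧸ G'`
for which `λ(τ) = (1,2,3,4)(5,6,7,8)` and `λ(σ) = (1,2)(3,5)(4,6)(7,8)`, where `τ = (1,2,3,4)` and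
`σ = (1,2)`. -/
structure Labelling (G' : Subgroup Gal(L/k)) where
  iso : Gal(L/k) ≃* Perm (Fin 4)
  map_iso : G'.map iso.toMonoidHom = Subgroup.zpowers (List.formPerm [2, 3, 4])
  enum : (Gal(L/k) ⧸ G') ≃ Fin 8
  lam_tau : enum.permCongr (lam G' (iso.symm tau)) = lamTau
  lam_sigma : enum.permCongr (lam G' (iso.symm sigma)) = lamSigma

namespace Labelling

variable {G' : Subgroup Gal(L/k)} (E : Labelling G')

/-- A permutation of `{1, …, 8}` as a permutation of `G ⧸ G'`. -/
def perm (p : Perm (Fin 8)) : Perm (Gal(L/k) ⧸ G') := E.enum.symm.permCongr p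

def N₃ : Subgroup (Perm (Gal(L/k) ⧸ G')) := Subgroup.closure {E.perm r₃, E.perm s₃, E.perm t₃}

def N₄ : Subgroup (Perm (Gal(L/k) ⧸ G')) := Subgroup.closure {E.perm r₄, E.perm s₄, E.perm t₄}

end Labelling

end Permutations

end

end HopfGalois

/-! Write `H = L[N]^G`. Galois descent makes `H` a `k`-form of `L[N]`: families dual with respect to
the Galois group express each `n ∈ N` as an `L`-combination of traces (`exists_single_eq_sum`), so a
`k`-basis of `H` is an `L`-basis of `L[N]`. Hence `dim H = |N|`, and cocommutativity descends.

The action `μ` extends `L`-linearly to `preActHom`, which sends `n` to the coset embedding `n⁻¹(1̄)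
: K → L`. Distinct cosets give distinct embeddings, so by Dedekind's independence of characters and
regularity of `N` the extension is injective. The module algebra axioms can be checked on group
elements; injectivity makes the Galois map injective, and counting dimensions makes it bijective
(`isHopfGaloisStructure`).

An isomorphism of structures, extended to `L`, must match `n` with the `n'` having `n'⁻¹(1̄) =
n⁻¹(1̄)`. It is multiplicative, so this matching respects products, and hence matched elements agree
as permutations of all cosets (`le_of_hopfGaloisIsomorphic`). Non-isomorphism thus reduces to `r₃ ∉
N₄`.

Yet in the coordinates given by their three generators, both groups carry the same action of `τ` and
`σ`, which generate `S₄`. The map matching generators is therefore equivariant and induces a Hopf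
algebra isomorphism. It is the only one (`eq_isoN`), since the action singles out the generators:
`t` is the nontrivial element fixed by `τ`, `s` is the nontrivial element on which `τ` and `σ`
agree, and `r` is the image of `t` under `τσ`. -/

namespace HopfGalois

noncomputable section

universe u v w w'

/-! ### Galois descent for the fixed algebra. -/

section FixedAlgebra

variable {k : Type u} {L : Type v} [Field k] [Field L] [Algebra k L]
variable [FiniteDimensional k L] [IsGalois k L]
variable {N : Type w} [Group N] (θ : Gal(L/k) →* MulAut N)

/-- With `T i` the trace of `x i • n`, the sum expands to `∑_h (∑_i y i * h (x i)) θ_h(n)`, and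
duality kills every term except `h = 1`. -/
theorem exists_single_eq_sum (n : N) : ∃ (m : ℕ) (y : Fin m → L) (T : Fin m → fixedAlgebra θ),
    MonoidAlgebra.single n (1 : L) = ∑ i, y i • (T i : MonoidAlgebra L N) := by
  classical
  obtain ⟨m, x, y, hxy⟩ := exists_dual (k := k) (L := L)
  refine ⟨m, y, fun i => tr θ (MonoidAlgebra.single n (x i)), ?_⟩
  simp_rw [coe_tr, act_single, Finset.smul_sum, MonoidAlgebra.smul_single, smul_eq_mul]
  rw [Finset.sum_comm]
  have h1 : ∀ h : Gal(L/k), ∑ i, MonoidAlgebra.single (θ h n) (y i * h (x i)) =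
      MonoidAlgebra.single (θ h n) (if 1 = h then (1 : L) else 0) := fun h => by
    rw [← hxy 1 h]
    exact (map_sum (MonoidAlgebra.singleAddHom (θ h n)) _ _).symm
  simp_rw [h1]
  rw [Finset.sum_eq_single 1] <;> simp +contextual [eq_comm]

theorem span_fixedAlgebra :
    Submodule.span L (Set.range fun x : fixedAlgebra θ => (x : MonoidAlgebra L N)) = ⊤ := by
  refine eq_top_iff.2 fun x _ => ?_
  induction x using MonoidAlgebra.induction_linear with
  | zero => exact zero_mem _
  | add x y hx hy => exact add_mem (hx trivial) (hy trivial)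
  | single n b =>
    obtain ⟨m, y, T, h⟩ := exists_single_eq_sum θ n
    have hb : MonoidAlgebra.single n b = b • MonoidAlgebra.single n (1 : L) := by simp
    rw [hb, h]
    exact Submodule.smul_mem _ _ (Submodule.sum_mem _ fun i _ =>
      Submodule.smul_mem _ _ (Submodule.subset_span ⟨T i, rfl⟩))

/-- Every `k`-basis of `L[N]^G` is an `L`-basis of `L[N]`. -/
def basisOfFixed {ι : Type*} (b : Module.Basis ι k (fixedAlgebra θ)) :
    Module.Basis ι L (MonoidAlgebra L N) :=
  Module.Basis.mk (linearIndependent_val θ b.linearIndependent) <| by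
    rw [← span_fixedAlgebra θ, Submodule.span_le]
    rintro _ ⟨x, rfl⟩
    -- A fixed element is already a `k`-combination of `b`, and the `k`-span lies in the `L`-span.
    refine Submodule.span_subset_span k L _ ?_
    have hx : x ∈ Submodule.span k (Set.range b) := by rw [b.span_eq]; trivial
    have := Submodule.mem_map_of_mem (f := (fixedAlgebra θ).val.toLinearMap) hx
    rw [Submodule.map_span, ← Set.range_comp] at this
    exact this

theorem finite_fixedAlgebra [Finite N] : Module.Finite k (fixedAlgebra θ) := by
  let c : Module.Basis N L (MonoidAlgebra L N) := MonoidAlgebra.basis N L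
  have : Module.Finite L (MonoidAlgebra L N) := Module.Finite.of_basis c
  have := Module.Finite.finite_basis (basisOfFixed θ (Module.Basis.ofVectorSpace k (fixedAlgebra θ)))
  exact Module.Finite.of_basis (Module.Basis.ofVectorSpace k (fixedAlgebra θ))

/-- A `k`-basis of the fixed algebra and the group `N` index two `L`-bases of the same space. -/
theorem finrank_fixedAlgebra : Module.finrank k (fixedAlgebra θ) = Nat.card N := by
  let b := Module.Basis.ofVectorSpace k (fixedAlgebra θ)
  let c : Module.Basis N L (MonoidAlgebra L N) := MonoidAlgebra.basis N L
  rw [Module.finrank_eq_nat_card_basis b, ← Module.finrank_eq_nat_card_basis (basisOfFixed θ b),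
    Module.finrank_eq_nat_card_basis c]

theorem emb₂_comm (t : fixedAlgebra θ ⊗[k] fixedAlgebra θ) :
    emb₂ θ (TensorProduct.comm k _ _ t) = TensorProduct.comm L _ _ (emb₂ θ t) := by
  induction t with
  | zero => simp
  | add x y hx hy => simp only [map_add, hx, hy]
  | tmul x y => simp

/-- Inherited from `L[N]`, because `emb₂` is injective and commutes with the flip. -/
theorem isCocomm_fixedAlgebra : Coalgebra.IsCocomm k (fixedAlgebra θ) where
  comm_comp_comul := by
    ext x
    apply emb₂_injective θ
    change emb₂ θ (TensorProduct.comm k _ _ (comulHom θ x)) = emb₂ θ (comulHom θ x)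
    rw [emb₂_comm, emb₂_comulHom, Coalgebra.comm_comul]

/-! ### Equivariant isomorphisms induce Hopf algebra isomorphisms. -/

variable {N' : Type w'} [Group N'] (θ' : Gal(L/k) →* MulAut N')
variable (Φ : N ≃* N')

theorem mapDomain_act (hΦ : ∀ g n, Φ (θ g n) = θ' g (Φ n)) (g : Gal(L/k))
    (x : MonoidAlgebra L N) :
    MonoidAlgebra.mapDomain Φ (act θ g x) = act θ' g (MonoidAlgebra.mapDomain Φ x) := by
  induction x using MonoidAlgebra.induction_linear with
  | zero => simp
  | add x y hx hy => simp only [map_add, MonoidAlgebra.mapDomain_add, hx, hy]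
  | single n b => simp [hΦ]

/-- The algebra map `L[N]^G → L[N']^G` induced by an equivariant isomorphism `N ≃ N'`. -/
def fixedMap (hΦ : ∀ g n, Φ (θ g n) = θ' g (Φ n)) : fixedAlgebra θ →ₐ[k] fixedAlgebra θ' :=
  ((MonoidAlgebra.mapDomainAlgHom k L Φ.toMonoidHom).comp (fixedAlgebra θ).val).codRestrict _
    fun x g => by
      change act θ' g (MonoidAlgebra.mapDomain Φ (x : MonoidAlgebra L N)) =
        MonoidAlgebra.mapDomain Φ (x : MonoidAlgebra L N)
      rw [← mapDomain_act θ θ' Φ hΦ, x.2 g]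

theorem coe_fixedMap (hΦ : ∀ g n, Φ (θ g n) = θ' g (Φ n)) (x : fixedAlgebra θ) :
    (fixedMap θ θ' Φ hΦ x : MonoidAlgebra L N') =
      MonoidAlgebra.mapDomain Φ (x : MonoidAlgebra L N) := rfl

theorem mapDomain_symm_mapDomain {N : Type*} {N' : Type*} [Group N] [Group N'] (Φ : N ≃* N')
    (x : MonoidAlgebra L N) :
    MonoidAlgebra.mapDomain Φ.symm (MonoidAlgebra.mapDomain Φ x) = x := by
  induction x using MonoidAlgebra.induction_linear with
  | zero => simp
  | add x y hx hy => simp only [MonoidAlgebra.mapDomain_add, hx, hy]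
  | single n b => simp

theorem counit_mapDomain (x : MonoidAlgebra L N) :
    Coalgebra.counit (R := L) (MonoidAlgebra.mapDomain Φ x) = Coalgebra.counit (R := L) x := by
  induction x using MonoidAlgebra.induction_linear with
  | zero => simp
  | add x y hx hy => simp only [MonoidAlgebra.mapDomain_add, map_add, hx, hy]
  | single n b => simp

theorem comul_mapDomain (x : MonoidAlgebra L N) :
    Coalgebra.comul (R := L) (MonoidAlgebra.mapDomain Φ x) =
      TensorProduct.map (MonoidAlgebra.mapDomainAlgHom L L Φ.toMonoidHom).toLinearMap
        (MonoidAlgebra.mapDomainAlgHom L L Φ.toMonoidHom).toLinearMap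
        (Coalgebra.comul (R := L) x) := by
  induction x using MonoidAlgebra.induction_linear with
  | zero => simp
  | add x y hx hy => simp only [MonoidAlgebra.mapDomain_add, map_add, hx, hy]
  | single n b => simp [MonoidAlgebra.comul_single]

theorem emb₂_map_fixedMap (hΦ : ∀ g n, Φ (θ g n) = θ' g (Φ n))
    (t : fixedAlgebra θ ⊗[k] fixedAlgebra θ) :
    emb₂ θ' (Algebra.TensorProduct.map (fixedMap θ θ' Φ hΦ) (fixedMap θ θ' Φ hΦ) t) =
      TensorProduct.map (MonoidAlgebra.mapDomainAlgHom L L Φ.toMonoidHom).toLinearMap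
        (MonoidAlgebra.mapDomainAlgHom L L Φ.toMonoidHom).toLinearMap (emb₂ θ t) := by
  induction t with
  | zero => simp
  | add x y hx hy => simp only [map_add, hx, hy]
  | tmul x y => rfl

/-- The isomorphism of Hopf algebras `L[N]^G ≃ L[N']^G` induced by an equivariant isomorphism
`N ≃ N'`. -/
def fixedEquiv (hΦ : ∀ g n, Φ (θ g n) = θ' g (Φ n)) : fixedAlgebra θ ≃ₐc[k] fixedAlgebra θ' :=
  have hΦ' : ∀ g n, Φ.symm (θ' g n) = θ g (Φ.symm n) := fun g n => by
    rw [MulEquiv.symm_apply_eq, hΦ, MulEquiv.apply_symm_apply]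
  BialgEquiv.ofAlgEquiv
    (AlgEquiv.ofAlgHom (fixedMap θ θ' Φ hΦ) (fixedMap θ' θ Φ.symm hΦ')
      (AlgHom.ext fun x => Subtype.ext (mapDomain_symm_mapDomain Φ.symm x.1))
      (AlgHom.ext fun x => Subtype.ext (mapDomain_symm_mapDomain Φ x.1)))
    -- Compatibility with counit and comultiplication is tested after the injections `k → L` and
    -- `emb₂`, where it is a statement about group algebras over `L`.
    (AlgHom.ext fun x => (algebraMap k L).injective <| by
      change algebraMap k L (counitHom θ' (fixedMap θ θ' Φ hΦ x)) = algebraMap k L (counitHom θ x)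
      rw [algebraMap_counitHom, algebraMap_counitHom, coe_fixedMap, counit_mapDomain])
    (AlgHom.ext fun x => emb₂_injective θ' <| by
      change emb₂ θ' (Algebra.TensorProduct.map (fixedMap θ θ' Φ hΦ) (fixedMap θ θ' Φ hΦ)
        (comulHom θ x)) = emb₂ θ' (comulHom θ' (fixedMap θ θ' Φ hΦ x))
      rw [emb₂_map_fixedMap, emb₂_comulHom, emb₂_comulHom, coe_fixedMap, comul_mapDomain])

theorem coe_fixedEquiv (hΦ : ∀ g n, Φ (θ g n) = θ' g (Φ n)) (x : fixedAlgebra θ) :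
    (fixedEquiv θ θ' Φ hΦ x : MonoidAlgebra L N') =
      MonoidAlgebra.mapDomain Φ (x : MonoidAlgebra L N) := rfl

end FixedAlgebra

end

end HopfGalois

namespace HopfGalois

noncomputable section

universe u v

/-! ### The Hopf Galois structure of a regular normalized subgroup. -/

section GreitherPareigis

variable {k : Type u} {L : Type v} [Field k] [Field L] [Algebra k L]
variable [FiniteDimensional k L] [IsGalois k L] {G' : Subgroup Gal(L/k)}

/-- If `a` and `b` agree on the fixed field of `G'`, then `a⁻¹ * b` fixes that field, so it lies in
`G'` by the Galois correspondence. -/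
theorem cosetHom_injective :
    Function.Injective (cosetHom : Gal(L/k) ⧸ G' → IntermediateField.fixedField G' →ₐ[k] L) := by
  intro p q h
  induction p using QuotientGroup.induction_on with
  | H a =>
  induction q using QuotientGroup.induction_on with
  | H b =>
  rw [QuotientGroup.eq, ← IntermediateField.fixingSubgroup_fixedField G',
    IntermediateField.mem_fixingSubgroup_iff]
  intro x hx
  have h1 : a x = b x := DFunLike.congr_fun h (⟨x, hx⟩ : IntermediateField.fixedField G')
  rw [AlgEquiv.mul_apply, ← h1]
  exact a.symm_apply_apply x

/-- Dedekind's independence of characters. -/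
theorem linearIndependent_cosetHom : LinearIndependent L
    (fun (q : Gal(L/k) ⧸ G') (x : IntermediateField.fixedField G') => cosetHom q x) := by
  have h := (linearIndependent_monoidHom (IntermediateField.fixedField G') L).comp
    (fun q : Gal(L/k) ⧸ G' => (cosetHom q : IntermediateField.fixedField G' →* L))
    (fun p q hpq => cosetHom_injective (AlgHom.ext fun x => DFunLike.congr_fun hpq x))
  exact h

variable (N : Subgroup (Equiv.Perm (Gal(L/k) ⧸ G')))

/-- `preAct` as an `L`-linear map from `L[N]` to functions on the fixed field. -/
def preActHom : MonoidAlgebra L N →ₗ[L] (IntermediateField.fixedField G' → L) where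
  toFun h x := preAct N h x
  map_add' h h' := funext fun x => by
    simp only [preAct, MonoidAlgebra.coeff_add, Pi.add_apply]
    exact Finsupp.sum_add_index' (by simp) (by intros; ring)
  map_smul' c h := funext fun x => by
    have := Fintype.ofFinite N
    simp only [preAct, Pi.smul_apply, RingHom.id_apply, smul_eq_mul]
    rw [Finsupp.sum_fintype _ _ (by simp), Finsupp.sum_fintype _ _ (by simp), Finset.mul_sum]
    exact Finset.sum_congr rfl fun n _ => mul_assoc c _ _

theorem preActHom_apply (h : MonoidAlgebra L N) (x : IntermediateField.fixedField G') :
    preActHom N h x = preAct N h x := rfl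

theorem preActHom_single (n : N) (a : L) (x : IntermediateField.fixedField G') :
    preActHom N (MonoidAlgebra.single n a) x = a * cosetHom
      ((n : Equiv.Perm (Gal(L/k) ⧸ G'))⁻¹ ((1 : Gal(L/k)) : Gal(L/k) ⧸ G')) x := by
  simp [preActHom_apply, preAct]

theorem coe_hopfAction_eq_preActHom (hN : Normalized N) (h : fixedAlgebra (conjAct N hN))
    (x : IntermediateField.fixedField G') : (hopfAction N hN h x : L) = preActHom N h x := rfl

variable {N}

theorem IsRegular.bijective_inv_apply (hR : IsRegular N) (q : Gal(L/k) ⧸ G') :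
    Function.Bijective fun n : N => (n : Equiv.Perm (Gal(L/k) ⧸ G'))⁻¹ q := by
  constructor
  · intro m n hmn
    have := (hR q ((m : Equiv.Perm (Gal(L/k) ⧸ G'))⁻¹ q)).unique (y₁ := m⁻¹) (y₂ := n⁻¹) rfl
      hmn.symm
    exact inv_injective this
  · intro y
    obtain ⟨n, hn, -⟩ := hR q y
    exact ⟨n⁻¹, by simpa using hn⟩

/-- The basis `N` goes to embeddings attached to pairwise distinct cosets, by regularity; these are
linearly independent. -/
theorem preActHom_injective (hR : IsRegular N) : Function.Injective (preActHom N) := by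
  have h := linearIndependent_cosetHom.comp _
    (hR.bijective_inv_apply ((1 : Gal(L/k)) : Gal(L/k) ⧸ G')).1
  let c : Module.Basis N L (MonoidAlgebra L N) := MonoidAlgebra.basis N L
  refine injective_of_basis (k := L) (L := L) c (preActHom N) ?_
  convert h using 2 with n
  funext x
  rw [MonoidAlgebra.basis_apply, preActHom_single, one_mul]
  rfl

/-- Applying `g` to the sum defining the action and reindexing by conjugation, which the invariance
of `h` permits, moves the base point from `1̄` to `g1̄`. The formula for the action thus holds at
every coset. -/
theorem cosetHom_hopfAction (hN : Normalized N) (h : fixedAlgebra (conjAct N hN))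
    (q : Gal(L/k) ⧸ G') (x : IntermediateField.fixedField G') :
    cosetHom q (hopfAction N hN h x) = (h : MonoidAlgebra L N).coeff.sum fun n a =>
      a * cosetHom ((n : Equiv.Perm (Gal(L/k) ⧸ G'))⁻¹ q) x := by
  have := Fintype.ofFinite N
  induction q using QuotientGroup.induction_on with
  | H g =>
  rw [cosetHom_mk, coe_hopfAction, Finsupp.sum_fintype _ _ (by simp),
    Finsupp.sum_fintype _ _ (by simp), map_sum]
  refine Fintype.sum_equiv (conjAct N hN g).toEquiv _ _ fun n => ?_
  change _ = (h : MonoidAlgebra L N).coeff (conjAct N hN g n) *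
    cosetHom ((conjAct N hN g n : Equiv.Perm (Gal(L/k) ⧸ G'))⁻¹ _) x
  rw [map_mul, coeff_of_mem (conjAct N hN) h.2, ← cosetHom_lam]
  congr 3
  have h1 : lam G' g ((1 : Gal(L/k)) : Gal(L/k) ⧸ G') = (g : Gal(L/k) ⧸ G') := by
    change ((g * 1 : Gal(L/k)) : Gal(L/k) ⧸ G') = _
    rw [mul_one]
  rw [coe_conjAct, mul_inv_rev, mul_inv_rev, inv_inv, Equiv.Perm.mul_apply, Equiv.Perm.mul_apply,
    Equiv.Perm.inv_eq_iff_eq.2 h1.symm]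

/-- For group elements this is `(nm)⁻¹(1̄) = m⁻¹(n⁻¹(1̄))`, with `cosetHom_hopfAction` evaluated at
the coset `n⁻¹(1̄)`. -/
theorem preActHom_mul (hN : Normalized N) (y : MonoidAlgebra L N)
    (h : fixedAlgebra (conjAct N hN)) (x : IntermediateField.fixedField G') :
    preActHom N (y * (h : MonoidAlgebra L N)) x = preActHom N y (hopfAction N hN h x) := by
  induction y using MonoidAlgebra.induction_linear with
  | zero => simp
  | add y z hy hz => simp only [add_mul, map_add, Pi.add_apply, hy, hz]
  | single n b =>
    rw [preActHom_single, cosetHom_hopfAction]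
    -- Invariance of `h` is no longer needed: what remains is linear in `h`, so it can be checked on
    -- single terms.
    generalize (h : MonoidAlgebra L N) = z
    have := Fintype.ofFinite N
    rw [Finsupp.sum_fintype _ _ (by simp)]
    induction z using MonoidAlgebra.induction_linear with
    | zero => simp
    | add y z hy hz =>
      simp only [mul_add, map_add, Pi.add_apply, hy, hz, MonoidAlgebra.coeff_add,
        Finsupp.add_apply, add_mul, Finset.sum_add_distrib]
    | single m c =>
      rw [MonoidAlgebra.single_mul_single, preActHom_single, Finset.sum_eq_single m]
      · simp [mul_assoc]
      · intro m' _ hm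
        simp [hm.symm]
      · simp

theorem preActHom_one_right (y : MonoidAlgebra L N) :
    preActHom N y 1 = Coalgebra.counit (R := L) y := by
  induction y using MonoidAlgebra.induction_linear with
  | zero => simp
  | add y z hy hz => simp only [map_add, Pi.add_apply, hy, hz]
  | single n b => simp [preActHom_single]

/-- Evaluation of `preActHom` at a point. -/
def preActAt (N : Subgroup (Equiv.Perm (Gal(L/k) ⧸ G'))) (x : IntermediateField.fixedField G') :
    MonoidAlgebra L N →ₗ[L] L := LinearMap.proj x ∘ₗ preActHom N

/-- Group elements are grouplike and act by ring homomorphisms. -/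
theorem preActHom_mul_right (z : MonoidAlgebra L N) (x y : IntermediateField.fixedField G') :
    preActHom N z (x * y) = LinearMap.mul' L L
      (TensorProduct.map (preActAt N x) (preActAt N y) (Coalgebra.comul (R := L) z)) := by
  induction z using MonoidAlgebra.induction_linear with
  | zero => simp
  | add y z hy hz => simp only [map_add, Pi.add_apply, hy, hz]
  | single n b =>
    simp [preActHom_single, preActAt, MonoidAlgebra.comul_single]
    ring

theorem coe_mul'_map_hopfAction (hN : Normalized N) (x y : IntermediateField.fixedField G')
    (t : fixedAlgebra (conjAct N hN) ⊗[k] fixedAlgebra (conjAct N hN)) :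
    (LinearMap.mul' k (IntermediateField.fixedField G') (TensorProduct.map
      ((hopfAction N hN).flip x) ((hopfAction N hN).flip y) t) : L) =
      LinearMap.mul' L L (TensorProduct.map (preActAt N x) (preActAt N y)
        (emb₂ (conjAct N hN) t)) := by
  induction t with
  | zero => simp
  | add s t hs ht => simp only [map_add, IntermediateField.coe_add, hs, ht]
  | tmul s t => rfl

/-- Both numbers are the index of `G'`. -/
theorem card_eq_finrank (hR : IsRegular N) :
    Nat.card N = Module.finrank k (IntermediateField.fixedField G') := by
  rw [Nat.card_eq_of_bijective _ (hR.bijective_inv_apply ((1 : Gal(L/k)) : Gal(L/k) ⧸ G')),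
    IntermediateField.finrank_eq_fixingSubgroup_index,
    IntermediateField.fixingSubgroup_fixedField]
  rfl

theorem galoisMap_injective (hR : IsRegular N) (hN : Normalized N) :
    Function.Injective (galoisMap (hopfAction N hN)) := by
  have hli := linearIndependent_val (conjAct N hN) (basisH (conjAct N hN)).linearIndependent
  have hli' := (hli.map' (preActHom N) (LinearMap.ker_eq_bot.2 (preActHom_injective hR)))
  let b := (basisH (conjAct N hN)).baseChange (IntermediateField.fixedField G')
  let F : Module.End k (IntermediateField.fixedField G') →ₗ[k]
      (IntermediateField.fixedField G' → L) :=
    { toFun := fun f x => (f x : L)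
      map_add' := fun _ _ => rfl
      map_smul' := fun _ _ => rfl }
  suffices h : Function.Injective (F ∘ₗ galoisMap (hopfAction N hN)) from
    Function.Injective.of_comp (f := F) h
  -- Seen as `K`-linear, the Galois map sends the `K`-basis `1 ⊗ bᵢ` to the functions `x ↦ bᵢ(x)`,
  -- which are independent even over `L`.
  let F' : IntermediateField.fixedField G' ⊗[k] fixedAlgebra (conjAct N hN)
      →ₗ[IntermediateField.fixedField G'] (IntermediateField.fixedField G' → L) :=
    { toFun := F ∘ₗ galoisMap (hopfAction N hN)
      map_add' := map_add _
      map_smul' := fun c t => by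
        induction t with
        | zero => simp
        | add s t hs ht => simp only [smul_add, map_add, hs, ht]
        | tmul s t =>
          funext x
          exact mul_assoc (c : L) s _ }
  refine injective_of_basis (L := L) b F' ?_
  suffices h : (fun i => F' (b i)) =
      preActHom N ∘ fun i => (basisH (conjAct N hN) i : MonoidAlgebra L N) by
    rw [h]
    exact hli'
  funext i x
  have : F' (b i) x = ((1 : IntermediateField.fixedField G') : L) *
      (hopfAction N hN (basisH (conjAct N hN) i) x : L) := by
    rw [Module.Basis.baseChange_apply]; rfl
  rw [this, IntermediateField.coe_one, one_mul]
  rfl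

/-- A regular subgroup normalized by `λ(G)` gives a Hopf Galois structure. -/
theorem isHopfGaloisStructure (hR : IsRegular N) (hN : Normalized N) :
    IsHopfGaloisStructure (hopfAction N hN) where
  finite := finite_fixedAlgebra _
  cocomm := isCocomm_fixedAlgebra _
  map_one := by
    ext x
    rw [coe_hopfAction_eq_preActHom, Subalgebra.coe_one, MonoidAlgebra.one_def, preActHom_single,
      one_mul, Subgroup.coe_one, inv_one]
    rfl
  map_mul h h' := by
    ext x
    exact preActHom_mul hN _ h' x
  apply_one h := Subtype.ext <| by
    rw [coe_hopfAction_eq_preActHom, preActHom_one_right, ← algebraMap_counitHom]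
    rfl
  apply_mul h x y := Subtype.ext <| by
    rw [coe_mul'_map_hopfAction, comul_eq, emb₂_comulHom, ← preActHom_mul_right]
    rfl
  bijective := by
    have := finite_fixedAlgebra (conjAct N hN)
    have hi := galoisMap_injective hR hN
    refine ⟨hi, (LinearMap.injective_iff_surjective_of_finrank_eq_finrank ?_).1 hi⟩
    -- Source and target both have dimension `[K:k]²`.
    rw [Module.finrank_tensorProduct, finrank_fixedAlgebra, card_eq_finrank hR,
      Module.finrank_linearMap]

/-! ### Isomorphic structures come from the same subgroup. -/

section Isomorphic

variable {N' : Subgroup (Equiv.Perm (Gal(L/k) ⧸ G'))} {hN : Normalized N} {hN' : Normalized N'}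
variable {f : fixedAlgebra (conjAct N hN) →ₐ[k] fixedAlgebra (conjAct N' hN')}

/-- The `L`-linear extension of `f` sends `n` to `n'`: both sides act as the same coset embedding,
and `preActHom N'` is injective. -/
theorem single_eq_sum_map (hR' : IsRegular N')
    (hf : ∀ t, preActHom N' (f t : MonoidAlgebra L N') = preActHom N (t : MonoidAlgebra L N))
    {n : N} {n' : N'} (hn : (n' : Equiv.Perm (Gal(L/k) ⧸ G'))⁻¹ ((1 : Gal(L/k)) : Gal(L/k) ⧸ G') =
      (n : Equiv.Perm (Gal(L/k) ⧸ G'))⁻¹ ((1 : Gal(L/k)) : Gal(L/k) ⧸ G'))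
    {l : ℕ} {y : Fin l → L} {T : Fin l → fixedAlgebra (conjAct N hN)}
    (hT : MonoidAlgebra.single n (1 : L) = ∑ i, y i • (T i : MonoidAlgebra L N)) :
    MonoidAlgebra.single n' (1 : L) = ∑ i, y i • (f (T i) : MonoidAlgebra L N') := by
  apply preActHom_injective hR'
  have h1 := congrArg (preActHom N) hT
  rw [map_sum] at h1 ⊢
  simp only [map_smul, hf] at h1 ⊢
  rw [← h1]
  funext x
  rw [preActHom_single, preActHom_single, one_mul, one_mul, hn]

/-- The extension of `f` is multiplicative and preserves the action, so `n * m` and `n' * m'` act by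
the same embedding, which determines the coset. -/
theorem mul_inv_apply_eq (hR' : IsRegular N')
    (hf : ∀ t, preActHom N' (f t : MonoidAlgebra L N') = preActHom N (t : MonoidAlgebra L N))
    {n m : N} {n' m' : N'}
    (hn : (n' : Equiv.Perm (Gal(L/k) ⧸ G'))⁻¹ ((1 : Gal(L/k)) : Gal(L/k) ⧸ G') =
      (n : Equiv.Perm (Gal(L/k) ⧸ G'))⁻¹ ((1 : Gal(L/k)) : Gal(L/k) ⧸ G'))
    (hm : (m' : Equiv.Perm (Gal(L/k) ⧸ G'))⁻¹ ((1 : Gal(L/k)) : Gal(L/k) ⧸ G') =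
      (m : Equiv.Perm (Gal(L/k) ⧸ G'))⁻¹ ((1 : Gal(L/k)) : Gal(L/k) ⧸ G')) :
    ((n' * m' : N') : Equiv.Perm (Gal(L/k) ⧸ G'))⁻¹ ((1 : Gal(L/k)) : Gal(L/k) ⧸ G') =
      ((n * m : N) : Equiv.Perm (Gal(L/k) ⧸ G'))⁻¹ ((1 : Gal(L/k)) : Gal(L/k) ⧸ G') := by
  obtain ⟨l, y, T, hT⟩ := exists_single_eq_sum (conjAct N hN) n
  obtain ⟨l', y', T', hT'⟩ := exists_single_eq_sum (conjAct N hN) m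
  have h1 := single_eq_sum_map hR' hf hn hT
  have h2 := single_eq_sum_map hR' hf hm hT'
  have h3 : preActHom N' (MonoidAlgebra.single (n' * m') 1) =
      preActHom N (MonoidAlgebra.single (n * m) 1) := by
    rw [← one_mul (1 : L), ← MonoidAlgebra.single_mul_single, ← MonoidAlgebra.single_mul_single,
      h1, h2, hT, hT', Finset.sum_mul_sum, Finset.sum_mul_sum, map_sum, map_sum]
    refine Finset.sum_congr rfl fun i _ => ?_
    rw [map_sum, map_sum]
    refine Finset.sum_congr rfl fun j _ => ?_
    rw [smul_mul_smul_comm, smul_mul_smul_comm, map_smul, map_smul]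
    have := hf (T i * T' j)
    rw [map_mul f] at this
    exact congrArg ((y i * y' j) • ·) this
  refine cosetHom_injective (AlgHom.ext fun x => ?_)
  have h4 := congrFun h3 x
  rwa [preActHom_single, preActHom_single, one_mul, one_mul] at h4

/-- Regular subgroups giving isomorphic Hopf Galois structures are equal; this is the inclusion in
one direction. -/
theorem le_of_hopfGaloisIsomorphic (hR : IsRegular N) (hR' : IsRegular N')
    (h : HopfGaloisIsomorphic (hopfAction N hN) (hopfAction N' hN')) : N ≤ N' := by
  obtain ⟨f, hf⟩ := h
  let F : fixedAlgebra (conjAct N hN) →ₐ[k] fixedAlgebra (conjAct N' hN') :=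
    (BialgEquiv.toAlgEquiv f).toAlgHom
  have hf' : ∀ t, preActHom N' (F t : MonoidAlgebra L N') = preActHom N (t : MonoidAlgebra L N) := fun t => by
    funext x
    exact congrArg Subtype.val (LinearMap.congr_fun (hf t) x)
  have hb := hR.bijective_inv_apply ((1 : Gal(L/k)) : Gal(L/k) ⧸ G')
  have hb' := hR'.bijective_inv_apply ((1 : Gal(L/k)) : Gal(L/k) ⧸ G')
  intro p hp
  obtain ⟨m', hm'⟩ := hb'.2 (p⁻¹ ((1 : Gal(L/k)) : Gal(L/k) ⧸ G'))
  have : p = m' := by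
    apply inv_injective
    ext q : 1
    obtain ⟨n, hn⟩ := hb.2 q
    obtain ⟨n', hn'⟩ := hb'.2 q
    -- With `q = n⁻¹(1̄) = n'⁻¹(1̄)`, comparing `(np)⁻¹(1̄)` and `(n'm')⁻¹(1̄)` gives `p⁻¹(q) =
    -- m'⁻¹(q)`.
    have := mul_inv_apply_eq hR' hf' (hn'.trans hn.symm) (m := ⟨p, hp⟩) hm'
    simp only [Subgroup.coe_mul, mul_inv_rev, Equiv.Perm.mul_apply] at this
    dsimp only at hn hn'
    rw [hn, hn'] at this
    exact this.symm
  rw [this]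
  exact m'.2

end Isomorphic

end GreitherPareigis

end

end HopfGalois

namespace HopfGalois

noncomputable section

/-! ### Finite computations in `S₄` and `S₈`. -/

open Equiv

/-- The elementary abelian group of order `8`. -/
abbrev Elem8 : Type := Multiplicative (ZMod 2 × ZMod 2 × ZMod 2)

/-- The first generator of `Elem8`. -/
def vr : Elem8 := .ofAdd (1, 0, 0)

/-- The second generator of `Elem8`. -/
def vs : Elem8 := .ofAdd (0, 1, 0)

/-- The third generator of `Elem8`. -/
def vt : Elem8 := .ofAdd (0, 0, 1)

theorem closure_generators : Subgroup.closure {vr, vs, vt} = (⊤ : Subgroup Elem8) := by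
  refine eq_top_iff.2 fun v _ => ?_
  have h : ∀ v : Elem8,
      v = vr ^ v.toAdd.1.val * vs ^ v.toAdd.2.1.val * vt ^ v.toAdd.2.2.val := by decide +kernel
  rw [h v]
  exact mul_mem (mul_mem (pow_mem (Subgroup.subset_closure (by simp)) _)
    (pow_mem (Subgroup.subset_closure (by simp)) _))
    (pow_mem (Subgroup.subset_closure (by simp)) _)

/-- The regular representation `(a, b, c) ↦ r₃ᵃ s₃ᵇ t₃ᶜ`. -/
def rep₃ : Elem8 →* Perm (Fin 8) where
  toFun v := r₃ ^ v.toAdd.1.val * s₃ ^ v.toAdd.2.1.val * t₃ ^ v.toAdd.2.2.val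
  map_one' := by decide +kernel
  map_mul' := by decide +kernel

/-- The regular representation `(a, b, c) ↦ r₄ᵃ s₄ᵇ t₄ᶜ`. -/
def rep₄ : Elem8 →* Perm (Fin 8) where
  toFun v := r₄ ^ v.toAdd.1.val * s₄ ^ v.toAdd.2.1.val * t₄ ^ v.toAdd.2.2.val
  map_one' := by decide +kernel
  map_mul' := by decide +kernel

theorem rep₃_vr : rep₃ vr = r₃ := by decide +kernel

theorem rep₃_vs : rep₃ vs = s₃ := by decide +kernel

theorem rep₃_vt : rep₃ vt = t₃ := by decide +kernel

theorem rep₄_vr : rep₄ vr = r₄ := by decide +kernel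

theorem rep₄_vs : rep₄ vs = s₄ := by decide +kernel

theorem rep₄_vt : rep₄ vt = t₄ := by decide +kernel

theorem closure_r₃_s₃_t₃ : Subgroup.closure {r₃, s₃, t₃} = rep₃.range := by
  apply le_antisymm
  · rw [Subgroup.closure_le]
    rintro _ (rfl | rfl | rfl)
    · exact ⟨vr, rep₃_vr⟩
    · exact ⟨vs, rep₃_vs⟩
    · exact ⟨vt, rep₃_vt⟩
  · rintro _ ⟨v, rfl⟩
    exact mul_mem (mul_mem (pow_mem (Subgroup.subset_closure (by simp)) _)
      (pow_mem (Subgroup.subset_closure (by simp)) _))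
      (pow_mem (Subgroup.subset_closure (by simp)) _)

theorem closure_r₄_s₄_t₄ : Subgroup.closure {r₄, s₄, t₄} = rep₄.range := by
  apply le_antisymm
  · rw [Subgroup.closure_le]
    rintro _ (rfl | rfl | rfl)
    · exact ⟨vr, rep₄_vr⟩
    · exact ⟨vs, rep₄_vs⟩
    · exact ⟨vt, rep₄_vt⟩
  · rintro _ ⟨v, rfl⟩
    exact mul_mem (mul_mem (pow_mem (Subgroup.subset_closure (by simp)) _)
      (pow_mem (Subgroup.subset_closure (by simp)) _))
      (pow_mem (Subgroup.subset_closure (by simp)) _)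

/-- The point is that one `v'` serves both representations: this is what makes the coordinate
isomorphism equivariant. -/
theorem conj_lamTau_rep (v : Elem8) : ∃ v' : Elem8,
    lamTau * rep₃ v * lamTau⁻¹ = rep₃ v' ∧ lamTau * rep₄ v * lamTau⁻¹ = rep₄ v' := by
  revert v; decide +kernel

theorem conj_lamSigma_rep (v : Elem8) : ∃ v' : Elem8,
    lamSigma * rep₃ v * lamSigma⁻¹ = rep₃ v' ∧ lamSigma * rep₄ v * lamSigma⁻¹ = rep₄ v' := by
  revert v; decide +kernel

theorem rep₃_regular : ∀ x y : Fin 8, ∃ v, rep₃ v x = y ∧ ∀ v', rep₃ v' x = y → v' = v := by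
  decide +kernel

theorem rep₄_regular : ∀ x y : Fin 8, ∃ v, rep₄ v x = y ∧ ∀ v', rep₄ v' x = y → v' = v := by
  decide +kernel

theorem r₃_ne_rep₄ : ∀ v, r₃ ≠ rep₄ v := by decide +kernel

/-- With `conj_t₃`, this forces the image of `t₃` under an equivariant isomorphism; the next lemma
and `conj_s₃` do the same for `s₃`. -/
theorem eq_t₄_of_conj_lamTau : ∀ v, lamTau * rep₄ v * lamTau⁻¹ = rep₄ v →
    v = 1 ∨ rep₄ v = t₄ := by decide +kernel

theorem eq_s₄_of_conj_lamTau_eq_conj_lamSigma :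
    ∀ v, lamTau * rep₄ v * lamTau⁻¹ = lamSigma * rep₄ v * lamSigma⁻¹ →
      v = 1 ∨ rep₄ v = s₄ := by decide +kernel

theorem conj_t₃ : lamTau * t₃ * lamTau⁻¹ = t₃ := by decide +kernel

theorem conj_s₃ : lamTau * s₃ * lamTau⁻¹ = lamSigma * s₃ * lamSigma⁻¹ := by decide +kernel

theorem conj_conj_t₃ : lamTau * (lamSigma * t₃ * lamSigma⁻¹) * lamTau⁻¹ = r₃ := by decide +kernel

theorem conj_conj_t₄ : lamTau * (lamSigma * t₄ * lamSigma⁻¹) * lamTau⁻¹ = r₄ := by decide +kernel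

theorem closure_tau_sigma : Subgroup.closure {tau, sigma} = (⊤ : Subgroup (Perm (Fin 4))) := by
  -- A full cycle and the transposition of a point with its image generate the symmetric group.
  have h := Perm.closure_cycle_adjacent_swap (σ := tau) (by
    refine ⟨1, by decide +kernel, ?_⟩
    intro y _
    have : ∀ y : Fin 4, ∃ n : Fin 4, (tau ^ (n : ℕ)) 1 = y := by decide +kernel
    obtain ⟨n, hn⟩ := this y
    exact ⟨n, by simpa using hn⟩) (by decide +kernel) 1
  have : tau 1 = 2 := by decide +kernel
  rwa [this] at h

/-- The `3`-cycles form a single conjugacy class; this lets any isomorphism with `S₄` be adjusted to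
put `G'` in standard position. -/
theorem exists_conj_of_pow_three : ∀ p : Perm (Fin 4), p ^ 3 = 1 → p ≠ 1 →
    ∃ c, c * p * c⁻¹ = List.formPerm [2, 3, 4] := by decide +kernel

/-- A labelling by `1, …, 8` of the cosets of `⟨(2,3,4)⟩` in `S₄`. The coset of `p` is determined by
`p 1` and the sign of `p`. -/
def cosetLabel (p : Perm (Fin 4)) : Fin 8 :=
  -- The trivial coset gets label `1`; equivariance for `τ` and `σ` forces the rest. The first entry
  -- of each vector belongs to `p 1 = 0`, the point written `4` in cycle notation.
  if Perm.sign p = 1 then ![6, 1, 8, 3] (p 1) else ![4, 7, 2, 5] (p 1)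

theorem cosetLabel_eq_iff : ∀ p q : Perm (Fin 4), cosetLabel p = cosetLabel q ↔
    (p⁻¹ * q) ∈ Subgroup.zpowers (List.formPerm [2, 3, 4] : Perm (Fin 4)) := by
  -- The subgroup consists of the even permutations fixing `1`, a description that can be decided.
  have h : ∀ p : Perm (Fin 4), p ∈ Subgroup.zpowers (List.formPerm [2, 3, 4] : Perm (Fin 4)) ↔
      p 1 = 1 ∧ Perm.sign p = 1 := by
    intro p
    constructor
    · rintro ⟨n, rfl⟩
      have h1 : (List.formPerm [2, 3, 4] : Perm (Fin 4)) 1 = 1 := by decide +kernel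
      exact ⟨Perm.zpow_apply_eq_self_of_apply_eq_self h1 n, by simp⟩
    · have : ∀ p : Perm (Fin 4), p 1 = 1 ∧ Perm.sign p = 1 →
          ∃ n : Fin 3, (List.formPerm [2, 3, 4] : Perm (Fin 4)) ^ (n : ℕ) = p := by decide +kernel
      intro hp
      obtain ⟨n, hn⟩ := this p hp
      exact ⟨n, by simpa using hn⟩
  simp_rw [h]
  decide +kernel

theorem cosetLabel_surjective : Function.Surjective cosetLabel := by
  unfold Function.Surjective
  decide +kernel

theorem cosetLabel_tau : ∀ p, cosetLabel (tau * p) = lamTau (cosetLabel p) := by decide +kernel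

theorem cosetLabel_sigma : ∀ p, cosetLabel (sigma * p) = lamSigma (cosetLabel p) := by
  decide +kernel

end

end HopfGalois

namespace HopfGalois

noncomputable section

universe u v

open Equiv

/-! ### Existence of a labelling. -/

namespace Labelling

variable {k : Type u} {L : Type v} [Field k] [Field L] [Algebra k L] {G' : Subgroup Gal(L/k)}

theorem exists_iso_map_eq (hG : Nonempty (Gal(L/k) ≃* Perm (Fin 4))) (hG' : Nat.card G' = 3) :
    ∃ e : Gal(L/k) ≃* Perm (Fin 4),
      G'.map e.toMonoidHom = Subgroup.zpowers (List.formPerm [2, 3, 4]) := by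
  obtain ⟨e⟩ := hG
  have : Fact (Nat.Prime 3) := ⟨Nat.prime_three⟩
  have hfin : Finite G' := Nat.finite_of_card_ne_zero (by omega)
  have : Nontrivial G' := by
    rw [← Finite.one_lt_card_iff_nontrivial]; omega
  obtain ⟨g, hg⟩ := exists_ne (1 : G')
  have hz : G' = Subgroup.zpowers (g : Gal(L/k)) := by
    have h := zpowers_eq_top_of_prime_card hG' hg
    have h' := congrArg (Subgroup.map G'.subtype) h
    rw [MonoidHom.map_zpowers, ← MonoidHom.range_eq_map, Subgroup.range_subtype] at h'
    exact h'.symm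
  have h3 : e (g : Gal(L/k)) ^ 3 = 1 := by
    have : g ^ 3 = 1 := by rw [← hG']; exact pow_card_eq_one'
    rw [← map_pow, ← Subgroup.coe_pow, this, Subgroup.coe_one, map_one]
  have h1 : e (g : Gal(L/k)) ≠ 1 := by
    rw [Ne, EmbeddingLike.map_eq_one_iff]
    exact fun h => hg (Subtype.ext h)
  obtain ⟨c, hc⟩ := exists_conj_of_pow_three _ h3 h1
  -- `G'` is cyclic on `g`, so conjugating the image of `g` to `(2,3,4)` suffices.
  refine ⟨e.trans (MulAut.conj c), ?_⟩
  conv_lhs => rw [hz]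
  rw [MonoidHom.map_zpowers, ← hc]
  rfl

theorem nonempty (hG : Nonempty (Gal(L/k) ≃* Perm (Fin 4))) (hG' : Nat.card G' = 3) :
    Nonempty (Labelling G') := by
  obtain ⟨e, he⟩ := exists_iso_map_eq hG hG'
  have hmem : ∀ a b : Gal(L/k), cosetLabel (e a) = cosetLabel (e b) ↔ a⁻¹ * b ∈ G' := by
    intro a b
    rw [cosetLabel_eq_iff, ← he, ← map_inv, ← map_mul]
    exact Subgroup.mem_map_iff_mem (f := e.toMonoidHom) e.injective
  let F : Gal(L/k) ⧸ G' → Fin 8 := fun q => Quotient.liftOn' q (fun g => cosetLabel (e g))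
    fun a b hab => (hmem a b).2 (QuotientGroup.leftRel_apply.1 hab)
  have hF : Function.Bijective F := by
    constructor
    · intro p q hpq
      induction p using QuotientGroup.induction_on with
      | H a =>
      induction q using QuotientGroup.induction_on with
      | H b => exact QuotientGroup.eq.2 ((hmem a b).1 hpq)
    · intro i
      obtain ⟨p, hp⟩ := cosetLabel_surjective i
      refine ⟨(e.symm p : Gal(L/k)), ?_⟩
      change cosetLabel (e (e.symm p)) = i
      rw [MulEquiv.apply_symm_apply, hp]
  have hlam : ∀ (p : Perm (Fin 4)) (p' : Perm (Fin 8)),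
      (∀ q, cosetLabel (p * q) = p' (cosetLabel q)) →
      (Equiv.ofBijective F hF).permCongr (lam G' (e.symm p)) = p' := by
    intro p p' h
    ext1 i
    obtain ⟨q, rfl⟩ := (Equiv.ofBijective F hF).surjective i
    rw [Equiv.permCongr_apply, Equiv.symm_apply_apply]
    induction q using QuotientGroup.induction_on with
    | H a =>
    change cosetLabel (e (e.symm p * a)) = p' (cosetLabel (e a))
    rw [map_mul, MulEquiv.apply_symm_apply, h]
  exact ⟨⟨e, he, Equiv.ofBijective F hF, hlam _ _ cosetLabel_tau, hlam _ _ cosetLabel_sigma⟩⟩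

/-! ### Transfer of `N₃` and `N₄` to the cosets of `G'`. -/

variable (E : Labelling G')

/-- `Labelling.perm` as an isomorphism of groups. -/
def permHom : Perm (Fin 8) ≃* Perm (Gal(L/k) ⧸ G') := E.enum.symm.permCongrHom

/-- The permutation representation of `Elem8` on `G ⧸ G'` given by one on `{1, …, 8}`. -/
def rep (w : Elem8 →* Perm (Fin 8)) : Elem8 →* Perm (Gal(L/k) ⧸ G') :=
  E.permHom.toMonoidHom.comp w

theorem lam_iso_symm_tau : lam G' (E.iso.symm tau) = E.permHom lamTau := by
  rw [← E.lam_tau]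
  ext q
  simp [permHom]

theorem lam_iso_symm_sigma : lam G' (E.iso.symm sigma) = E.permHom lamSigma := by
  rw [← E.lam_sigma]
  ext q
  simp [permHom]

/-- Reduces normalization and equivariance under `G` to `τ` and `σ`. -/
theorem closure_iso_symm :
    Subgroup.closure {E.iso.symm tau, E.iso.symm sigma} = (⊤ : Subgroup Gal(L/k)) := by
  have h := congrArg (Subgroup.map E.iso.symm.toMonoidHom) closure_tau_sigma
  rw [MonoidHom.map_closure, Set.image_pair, Subgroup.map_top_of_surjective _
    E.iso.symm.surjective] at h
  exact h

theorem N₃_eq_range : E.N₃ = (E.rep rep₃).range := by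
  rw [rep, MonoidHom.range_comp, ← closure_r₃_s₃_t₃, MonoidHom.map_closure, Set.image_insert_eq,
    Set.image_pair]
  rfl

theorem N₄_eq_range : E.N₄ = (E.rep rep₄).range := by
  rw [rep, MonoidHom.range_comp, ← closure_r₄_s₄_t₄, MonoidHom.map_closure, Set.image_insert_eq,
    Set.image_pair]
  rfl

theorem isRegular_range_rep {w : Elem8 →* Perm (Fin 8)}
    (hw : ∀ x y : Fin 8, ∃ v, w v x = y ∧ ∀ v', w v' x = y → v' = v) :
    IsRegular (E.rep w).range := by
  intro x y
  have hrep : ∀ v, E.rep w v x = y ↔ w v (E.enum x) = E.enum y := fun v =>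
    E.enum.symm_apply_eq
  obtain ⟨v, hv, hv'⟩ := hw (E.enum x) (E.enum y)
  refine ⟨⟨E.rep w v, v, rfl⟩, (hrep v).2 hv, ?_⟩
  rintro ⟨_, v', rfl⟩ h
  exact Subtype.ext (congrArg (E.rep w) (hv' v' ((hrep v').1 h)))

theorem isRegular_N₃ : IsRegular E.N₃ := E.N₃_eq_range ▸ E.isRegular_range_rep rep₃_regular

theorem isRegular_N₄ : IsRegular E.N₄ := E.N₄_eq_range ▸ E.isRegular_range_rep rep₄_regular

theorem normalized_range_rep {w : Elem8 →* Perm (Fin 8)}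
    (hτ : ∀ v, ∃ v', lamTau * w v * lamTau⁻¹ = w v')
    (hσ : ∀ v, ∃ v', lamSigma * w v * lamSigma⁻¹ = w v') : Normalized (E.rep w).range := by
  have hconj : ∀ p : Perm (Fin 8), (∀ v, ∃ v', p * w v * p⁻¹ = w v') →
      E.permHom p ∈ Subgroup.normalizer ((E.rep w).range : Set (Perm (Gal(L/k) ⧸ G'))) := by
    intro p hp
    have : Finite ((E.rep w).range : Set (Perm (Gal(L/k) ⧸ G'))) :=
      Set.finite_range (E.rep w)
    -- For a finite subgroup, one inclusion under conjugation is enough.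
    refine Subgroup.mem_normalizer_fintype ?_
    rintro _ ⟨v, rfl⟩
    obtain ⟨v', hv'⟩ := hp v
    refine ⟨v', ?_⟩
    change E.permHom (w v') = E.permHom p * E.permHom (w v) * (E.permHom p)⁻¹
    rw [← hv', map_mul, map_mul, map_inv]
  rintro _ ⟨g, rfl⟩
  have hle : (⊤ : Subgroup Gal(L/k)) ≤ (Subgroup.normalizer
      ((E.rep w).range : Set (Perm (Gal(L/k) ⧸ G')))).comap (lam G') := by
    rw [← E.closure_iso_symm, Subgroup.closure_le]
    rintro _ (rfl | rfl)
    · change lam G' (E.iso.symm tau) ∈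
        Subgroup.normalizer ((E.rep w).range : Set (Perm (Gal(L/k) ⧸ G')))
      rw [lam_iso_symm_tau]
      exact hconj _ hτ
    · change lam G' (E.iso.symm sigma) ∈
        Subgroup.normalizer ((E.rep w).range : Set (Perm (Gal(L/k) ⧸ G')))
      rw [lam_iso_symm_sigma]
      exact hconj _ hσ
  exact hle (Subgroup.mem_top g)

theorem normalized_N₃ : Normalized E.N₃ :=
  E.N₃_eq_range ▸ E.normalized_range_rep (fun v => (conj_lamTau_rep v).imp fun _ h => h.1)
    fun v => (conj_lamSigma_rep v).imp fun _ h => h.1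

theorem normalized_N₄ : Normalized E.N₄ :=
  E.N₄_eq_range ▸ E.normalized_range_rep (fun v => (conj_lamTau_rep v).imp fun _ h => h.2)
    fun v => (conj_lamSigma_rep v).imp fun _ h => h.2

theorem not_N₃_le_N₄ : ¬ E.N₃ ≤ E.N₄ := by
  intro h
  have h1 : E.perm r₃ ∈ E.N₄ := h (Subgroup.subset_closure (by simp))
  rw [N₄_eq_range] at h1
  obtain ⟨v, hv⟩ := h1
  exact r₃_ne_rep₄ v (E.permHom.injective hv).symm

theorem injective_of_regular {w : Elem8 →* Perm (Fin 8)}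
    (hw : ∀ x y : Fin 8, ∃ v, w v x = y ∧ ∀ v', w v' x = y → v' = v) :
    Function.Injective (E.rep w) := by
  intro a b hab
  obtain ⟨v, -, hv⟩ := hw 1 (w b 1)
  rw [hv a (by rw [E.permHom.injective hab]), hv b rfl]

/-- The isomorphism `(a, b, c) ↦ r₃ᵃ s₃ᵇ t₃ᶜ` onto `N₃`. -/
def equiv₃ : Elem8 ≃* E.N₃ :=
  (MonoidHom.ofInjective (E.injective_of_regular rep₃_regular)).trans
    (MulEquiv.subgroupCongr E.N₃_eq_range.symm)

/-- The isomorphism `(a, b, c) ↦ r₄ᵃ s₄ᵇ t₄ᶜ` onto `N₄`. -/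
def equiv₄ : Elem8 ≃* E.N₄ :=
  (MonoidHom.ofInjective (E.injective_of_regular rep₄_regular)).trans
    (MulEquiv.subgroupCongr E.N₄_eq_range.symm)

theorem coe_equiv₃ (v : Elem8) : (E.equiv₃ v : Perm (Gal(L/k) ⧸ G')) = E.permHom (rep₃ v) := rfl

theorem coe_equiv₄ (v : Elem8) : (E.equiv₄ v : Perm (Gal(L/k) ⧸ G')) = E.permHom (rep₄ v) := rfl

section Conj

variable [FiniteDimensional k L] [IsGalois k L]
variable {N : Subgroup (Perm (Gal(L/k) ⧸ G'))} (hN : Normalized N) {n : N} {p : Perm (Fin 8)}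

theorem coe_conjAct_tau (hn : (n : Perm (Gal(L/k) ⧸ G')) = E.permHom p) :
    (conjAct N hN (E.iso.symm tau) n : Perm (Gal(L/k) ⧸ G')) =
      E.permHom (lamTau * p * lamTau⁻¹) := by
  rw [coe_conjAct, lam_iso_symm_tau, hn, map_mul, map_mul, map_inv]

theorem coe_conjAct_sigma (hn : (n : Perm (Gal(L/k) ⧸ G')) = E.permHom p) :
    (conjAct N hN (E.iso.symm sigma) n : Perm (Gal(L/k) ⧸ G')) =
      E.permHom (lamSigma * p * lamSigma⁻¹) := by
  rw [coe_conjAct, lam_iso_symm_sigma, hn, map_mul, map_mul, map_inv]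

end Conj

/-! ### The unique equivariant isomorphism from `N₃` to `N₄`. -/

variable [FiniteDimensional k L] [IsGalois k L]

/-- The isomorphism `N₃ ≃ N₄` taking `r₃, s₃, t₃` to `r₄, s₄, t₄`. -/
def isoN : E.N₃ ≃* E.N₄ := E.equiv₃.symm.trans E.equiv₄

theorem isoN_equiv₃ (v : Elem8) : E.isoN (E.equiv₃ v) = E.equiv₄ v := by simp [isoN]

theorem coe_isoN {n : E.N₃} {v : Elem8} (hn : (n : Perm (Gal(L/k) ⧸ G')) = E.permHom (rep₃ v)) :
    (E.isoN n : Perm (Gal(L/k) ⧸ G')) = E.permHom (rep₄ v) := by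
  rw [show n = E.equiv₃ v from Subtype.ext hn, isoN_equiv₃, coe_equiv₄]

theorem isoN_conjAct (h₃ : Normalized E.N₃) (h₄ : Normalized E.N₄) (g : Gal(L/k)) (n : E.N₃) :
    E.isoN (conjAct E.N₃ h₃ g n) = conjAct E.N₄ h₄ g (E.isoN n) := by
  -- Equivariance is recast as an equality of homomorphisms from `G` to the automorphisms of `N₄`,
  -- so that generators of `G` suffice.
  have h : (MulAut.congr E.isoN).toMonoidHom.comp (conjAct E.N₃ h₃) = conjAct E.N₄ h₄ := by
    refine MonoidHom.eq_of_eqOn_dense E.closure_iso_symm ?_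
    rintro _ (rfl | rfl) <;> ext1 m <;> apply Subtype.ext <;>
      obtain ⟨v, rfl⟩ := E.equiv₄.surjective m <;>
      change (E.isoN (conjAct E.N₃ h₃ _ (E.isoN.symm (E.equiv₄ v))) : Perm (Gal(L/k) ⧸ G')) = _ <;>
      rw [← isoN_equiv₃, MulEquiv.symm_apply_apply, isoN_equiv₃]
    · obtain ⟨v', hv₃, hv₄⟩ := conj_lamTau_rep v
      rw [E.coe_conjAct_tau h₄ (E.coe_equiv₄ v), hv₄]
      exact E.coe_isoN (by rw [E.coe_conjAct_tau h₃ (E.coe_equiv₃ v), hv₃])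
    · obtain ⟨v', hv₃, hv₄⟩ := conj_lamSigma_rep v
      rw [E.coe_conjAct_sigma h₄ (E.coe_equiv₄ v), hv₄]
      exact E.coe_isoN (by rw [E.coe_conjAct_sigma h₃ (E.coe_equiv₃ v), hv₃])
  rw [← h]
  change _ = E.isoN (conjAct E.N₃ h₃ g (E.isoN.symm (E.isoN n)))
  rw [MulEquiv.symm_apply_apply]

/-- The action alone characterizes `t` and `s` among nontrivial elements and produces `r` from `t`,
so `Ψ` is forced on generators. -/
theorem eq_isoN (h₃ : Normalized E.N₃) (h₄ : Normalized E.N₄) (Ψ : E.N₃ ≃* E.N₄)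
    (hΨ : ∀ (g : Gal(L/k)) (n : E.N₃), Ψ (conjAct E.N₃ h₃ g n) = conjAct E.N₄ h₄ g (Ψ n)) :
    Ψ = E.isoN := by
  -- Rules out the trivial solution of the conditions characterizing `t₄` and `s₄`.
  have hne : ∀ v u, Ψ (E.equiv₃ v) = E.equiv₄ u → v ≠ 1 → u ≠ 1 := by
    rintro v u huv hv rfl
    rw [map_one, EmbeddingLike.map_eq_one_iff, EmbeddingLike.map_eq_one_iff] at huv
    exact hv huv
  have ht : Ψ (E.equiv₃ vt) = E.equiv₄ vt := by
    obtain ⟨u, hu⟩ := E.equiv₄.surjective (Ψ (E.equiv₃ vt))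
    have h1 : conjAct E.N₃ h₃ (E.iso.symm tau) (E.equiv₃ vt) = E.equiv₃ vt := Subtype.ext <| by
      rw [E.coe_conjAct_tau h₃ (E.coe_equiv₃ vt), coe_equiv₃, rep₃_vt, conj_t₃]
    have h2 := congrArg Subtype.val (hΨ (E.iso.symm tau) (E.equiv₃ vt))
    rw [h1, ← hu, E.coe_conjAct_tau h₄ (E.coe_equiv₄ u), coe_equiv₄] at h2
    rw [← hu]
    refine Subtype.ext ?_
    rw [coe_equiv₄, coe_equiv₄, rep₄_vt, (eq_t₄_of_conj_lamTau u
      (E.permHom.injective h2).symm).resolve_left (hne _ _ hu.symm (by decide))]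
  have hs : Ψ (E.equiv₃ vs) = E.equiv₄ vs := by
    obtain ⟨u, hu⟩ := E.equiv₄.surjective (Ψ (E.equiv₃ vs))
    have h1 : conjAct E.N₃ h₃ (E.iso.symm tau) (E.equiv₃ vs) =
        conjAct E.N₃ h₃ (E.iso.symm sigma) (E.equiv₃ vs) := Subtype.ext <| by
      rw [E.coe_conjAct_tau h₃ (E.coe_equiv₃ vs), E.coe_conjAct_sigma h₃ (E.coe_equiv₃ vs),
        rep₃_vs, conj_s₃]
    have h2 := congrArg (fun n => (Ψ n : Perm (Gal(L/k) ⧸ G'))) h1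
    simp only [hΨ, ← hu] at h2
    rw [E.coe_conjAct_tau h₄ (E.coe_equiv₄ u), E.coe_conjAct_sigma h₄ (E.coe_equiv₄ u)] at h2
    rw [← hu]
    refine Subtype.ext ?_
    rw [coe_equiv₄, coe_equiv₄, rep₄_vs, (eq_s₄_of_conj_lamTau_eq_conj_lamSigma u
      (E.permHom.injective h2)).resolve_left (hne _ _ hu.symm (by decide))]
  have hr : Ψ (E.equiv₃ vr) = E.equiv₄ vr := by
    have h1 : E.equiv₃ vr = conjAct E.N₃ h₃ (E.iso.symm tau)
        (conjAct E.N₃ h₃ (E.iso.symm sigma) (E.equiv₃ vt)) := Subtype.ext <| by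
      rw [E.coe_conjAct_tau h₃ (E.coe_conjAct_sigma h₃ (E.coe_equiv₃ vt)), coe_equiv₃, rep₃_vr,
        rep₃_vt, conj_conj_t₃]
    rw [h1, hΨ, hΨ, ht]
    refine Subtype.ext ?_
    rw [E.coe_conjAct_tau h₄ (E.coe_conjAct_sigma h₄ (E.coe_equiv₄ vt)), coe_equiv₄, rep₄_vr,
      rep₄_vt, conj_conj_t₄]
  have h : Ψ.toMonoidHom.comp E.equiv₃.toMonoidHom = E.equiv₄.toMonoidHom := by
    refine MonoidHom.eq_of_eqOn_dense closure_generators ?_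
    rintro _ (rfl | rfl | rfl)
    exacts [hr, hs, ht]
  ext1 n
  obtain ⟨v, rfl⟩ := E.equiv₃.surjective n
  rw [isoN_equiv₃]
  exact DFunLike.congr_fun h v

end Labelling

theorem finrank_fixedField_eq_eight {k : Type u} {L : Type v} [Field k] [Field L] [Algebra k L]
    [FiniteDimensional k L] [IsGalois k L] (hG : Nonempty (Gal(L/k) ≃* Perm (Fin 4)))
    (G' : Subgroup Gal(L/k)) (hG' : Nat.card G' = 3) :
    Module.finrank k (IntermediateField.fixedField G') = 8 := by
  have h1 := Module.finrank_mul_finrank k (IntermediateField.fixedField G') L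
  have h2 : Module.finrank k L = 24 := by
    rw [← IsGalois.card_aut_eq_finrank k L, Nat.card_congr hG.some.toEquiv,
      Nat.card_eq_fintype_card, Fintype.card_perm]
    rfl
  rw [IntermediateField.finrank_fixedField_eq_card, hG', h2] at h1
  omega

end

end HopfGalois

open HopfGalois in
theorem mainTheorem1 {k : Type*} {L : Type*} [Field k] [Field L] [Algebra k L]
    [FiniteDimensional k L] [IsGalois k L]
    (hG : Nonempty (Gal(L/k) ≃* Equiv.Perm (Fin 4)))
    (G' : Subgroup Gal(L/k)) (hG' : Nat.card G' = 3) :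
    Module.finrank k (IntermediateField.fixedField G') = 8 ∧
    Nonempty (Labelling G') ∧
    ∀ E : Labelling G',
      IsRegular E.N₃ ∧ IsRegular E.N₄ ∧
      ∃ (h₃ : Normalized E.N₃) (h₄ : Normalized E.N₄),
        IsHopfGaloisStructure (hopfAction E.N₃ h₃) ∧
        IsHopfGaloisStructure (hopfAction E.N₄ h₄) ∧
        ¬ HopfGaloisIsomorphic (hopfAction E.N₃ h₃) (hopfAction E.N₄ h₄) ∧
        ∃ Φ : E.N₃ ≃* E.N₄,
          (∀ (g : Gal(L/k)) (n : E.N₃), Φ (conjAct E.N₃ h₃ g n) = conjAct E.N₄ h₄ g (Φ n)) ∧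
          (∀ Ψ : E.N₃ ≃* E.N₄,
            (∀ (g : Gal(L/k)) (n : E.N₃), Ψ (conjAct E.N₃ h₃ g n) = conjAct E.N₄ h₄ g (Ψ n)) →
              Ψ = Φ) ∧
          (∀ n : E.N₃,
            ((n : Equiv.Perm (Gal(L/k) ⧸ G')) = E.perm r₃ →
              (Φ n : Equiv.Perm (Gal(L/k) ⧸ G')) = E.perm r₄) ∧
            ((n : Equiv.Perm (Gal(L/k) ⧸ G')) = E.perm s₃ →
              (Φ n : Equiv.Perm (Gal(L/k) ⧸ G')) = E.perm s₄) ∧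
            ((n : Equiv.Perm (Gal(L/k) ⧸ G')) = E.perm t₃ →
              (Φ n : Equiv.Perm (Gal(L/k) ⧸ G')) = E.perm t₄)) ∧
          ∃ f : fixedAlgebra (conjAct E.N₃ h₃) ≃ₐc[k] fixedAlgebra (conjAct E.N₄ h₄),
            ∀ h, (f h : MonoidAlgebra L E.N₄) =
              MonoidAlgebra.mapDomain Φ (h : MonoidAlgebra L E.N₃) := by
  refine ⟨finrank_fixedField_eq_eight hG G' hG', Labelling.nonempty hG hG', fun E =>
    ⟨E.isRegular_N₃, E.isRegular_N₄, E.normalized_N₃, E.normalized_N₄,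
      isHopfGaloisStructure E.isRegular_N₃ _, isHopfGaloisStructure E.isRegular_N₄ _,
      -- An isomorphism of the structures would put `r₃` in `N₄`.
      fun h => E.not_N₃_le_N₄ (le_of_hopfGaloisIsomorphic E.isRegular_N₃ E.isRegular_N₄ h),
      E.isoN, E.isoN_conjAct _ _, E.eq_isoN _ _, fun n => ⟨?_, ?_, ?_⟩,
      fixedEquiv _ _ E.isoN (E.isoN_conjAct _ _), coe_fixedEquiv _ _ E.isoN _⟩⟩
  · rw [← rep₃_vr, ← rep₄_vr]
    exact E.coe_isoN
  · rw [← rep₃_vs, ← rep₄_vs]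
    exact E.coe_isoN
  · rw [← rep₃_vt, ← rep₄_vt]
    exact E.coe_isoN
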